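/- **Setting.** Let $\mathbb M_2=\mathbb R^2$ be two-dimensional Minkowski space and let $\mathcal F$ be the space of smooth functionals $F\colon C^\infty(\mathbb M_2)\to\mathbb C$ of real configurations: $F$ is smooth along every finite-dimensional affine family of configurations, and for every $n$ and $\varphi$ the functional derivative $\frac{\delta^nF}{\delta\varphi^n}[\varphi]$ exists as a compactly supported distribution on $\mathbb M_2^n$, i.e. $\big\langle\frac{\delta^nF}{\delta\varphi^n}[\varphi],h_1\otimes\dots\otimes h_n\big\rangle=\partial_{s_1}\cdots\partial_{s_n}F[\varphi+\sum_j s_jh_j]\big|_{s=0}$. (All microcausal functionals belong to $\mathcal F$.) Products in $\mathcal F$ are pointwise, and functional derivatives in $\mathcal F[[\hbar]]$ are taken coefficientwise. Let $\Delta^F$ be the Feynman propagator or, more generally, any bidistribution on $\mathbb M_2$. For $1\le i<j\le n$ put $D^{ij}_F=\langle\Delta^F,\frac{\delta}{\delta\varphi_i}\otimes\frac{\delta}{\delta\varphi_j}\rangle$, where $\frac{\delta}{\delta\varphi_i}$ acts on the $i$-th tensor factor, and let $\mu$ denote pointwise multiplication of the factors. The (unrenormalized) time-ordered product of $F_1,\dots,F_n\in\mathcal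 F[[\hbar]]$ is $$T_n(F_1\otimes\dots\otimes F_n)=\mu\circ e^{\hbar\sum_{i<j}D^{ij}_F}(F_1\otimes\dots\otimes F_n),$$ where the exponential series is expanded into words in the $D_F^{ij}$ and everything is $\hbar$-multilinear. Each term is a pairing of a tensor product of functional derivatives of the $F_i$ with a product of propagators, one for each $D_F^{ij}$. Such a pairing is called well defined, with value $z$, if for every mollifier $\rho$ ($\rho\in C_c^\infty(\mathbb M_2)$, $\rho\ge 0$, $\int\rho=1$, $\rho_\varepsilon=\varepsilon^{-2}\rho(\cdot/\varepsilon)$) the pairings obtained by replacing $\Delta^F$ by the smooth function $\Delta^F_\varepsilon(x,y)=\langle\Delta^F,\rho_\varepsilon(x-\cdot)\otimes\rho_\varepsilon(y-\cdot)\rangle$ converge to $z$ as $\varepsilon\to0^+$. For $d_1,\dots,d_n\ge0$ with $d=d_1+\dots+d_n$ and $C\in\mathcal F[[\hbar]]$, the expression $$(\Delta^F)^{d}\,T_n\Big(\frac{\delta^{d_1}}{\delta\varphi^{d_1}}F_1\otimes\dots\otimes\frac{\delta^{d_n}}{\delta\varphi^{d_n}}F_n\Big)\frac{\delta^{d}}{\delta\varphi^{d}}C$$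 denotes the series obtained from that of $T_n(F_1\otimes\dots\otimes F_n)$ by adding to each term the further factor $C$ and $d$ further propagators, of which $d_t$ join $F_t$ to $C$, for each $t$; all arguments are paired simultaneously. **Proposition.** Let $l,c\ge0$, let $A_1,\dots,A_l,B,C\in\mathcal F[[\hbar]]$, and suppose that $\frac{\delta^i}{\delta\varphi^i}C=0$ for all $i>c$ (no such restriction is made on the $A_t$ and $B$). Suppose that all the pairings occurring in the terms on the right-hand side below, taken for all coefficients of the series $A_t,B,C$ and at all configurations, are well defined. Then all those occurring in $T_{l+1}(A_1\otimes\dots\otimes A_l\otimes(B\,C))$ are well defined, and $$T_{l+1}\big(A_1\otimes\dots\otimes A_l\otimes(B\,C)\big)=\sum_{i=0}^{c}\hbar^i(\Delta^F)^i\sum_{\substack{i_1,\dots,i_l\ge0\\ i_1+\dots+i_l=i}}\frac{1}{i_1!\cdots i_l!}\,T_{l+1}\Big(\frac{\delta^{i_1}}{\delta\varphi^{i_1}}A_1\otimes\dots\otimes\frac{\delta^{i_l}}{\delta\varphi^{i_l}}A_l\otimes B\Big)\frac{\delta^i}{\delta\varphi^i}C .$$ In particular, for $A_1=\dots=A_l=A$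 this is the formula for $T_{l+1}\big(A^{\otimes l}\otimes(B\,C)\big)$. -/

import Mathlib

open scoped ContDiff Topology Distributions

noncomputable section

namespace PAQFT

/-! ### Configurations, functionals, compactly supported distributions -/

/-- Two-dimensional Minkowski space `𝕄₂`, as the affine manifold `ℝ²`. (The metric enters the
constructions below only through the propagator.) -/
abbrev Spacetime : Type := EuclideanSpace ℝ (Fin 2)

/-- The space `C^∞(𝕄₂)` of (real) field configurations. -/
def Config : Submodule ℝ (Spacetime → ℝ) where
  carrier := {f | ContDiff ℝ ∞ f}
  add_mem' hf hg := by
    rw [Set.mem_ofPred_eq] at *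
    exact hf.add hg
  zero_mem' := by
    rw [Set.mem_ofPred_eq]
    exact contDiff_const
  smul_mem' c _ hf := by
    rw [Set.mem_ofPred_eq] at *
    exact hf.const_smul c

/-- A functional `F : C^∞(𝕄₂) → ℂ`. Sums and products of functionals are pointwise. -/
abbrev Functional : Type := Config → ℂ

/-- `C^∞(𝕄₂^L, ℂ)`: smooth functions of one spacetime point for each `j ∈ L`. -/
def SmoothFun (L : Type) [Fintype L] : Submodule ℂ ((L → Spacetime) → ℂ) where
  carrier := {f | ContDiff ℝ ∞ f}
  add_mem' hf hg := by
    rw [Set.mem_ofPred_eq] at *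
    exact hf.add hg
  zero_mem' := by
    rw [Set.mem_ofPred_eq]
    exact contDiff_const
  smul_mem' c _ hf := by
    rw [Set.mem_ofPred_eq] at *
    exact hf.const_smul c

/-- The space `𝓔'(𝕄₂^L)` of compactly supported distributions: linear forms on `C^∞(𝕄₂^L, ℂ)`
bounded by the size of finitely many derivatives on a compact set. -/
def CompactDistribution (L : Type) [Fintype L] : Submodule ℂ (SmoothFun L →ₗ[ℂ] ℂ) where
  carrier := {u | ∃ (K : Set (L → Spacetime)) (m : ℕ) (M : ℝ), IsCompact K ∧
    ∀ (f : SmoothFun L) (b : ℝ),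
      (∀ i ≤ m, ∀ x ∈ K, ‖iteratedFDeriv ℝ i (f : (L → Spacetime) → ℂ) x‖ ≤ b) →
        ‖u f‖ ≤ M * b}
  add_mem' := by
    rintro u v ⟨K, m, M, hK, hu⟩ ⟨K', m', M', hK', hv⟩
    refine ⟨K ∪ K', max m m', M + M', hK.union hK', fun f b hb => ?_⟩
    have h1 := hu f b fun i hi x hx => hb i (hi.trans (le_max_left _ _)) x (Or.inl hx)
    have h2 := hv f b fun i hi x hx => hb i (hi.trans (le_max_right _ _)) x (Or.inr hx)
    calc ‖(u + v) f‖ ≤ ‖u f‖ + ‖v f‖ := norm_add_le _ _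
      _ ≤ (M + M') * b := by linarith
  zero_mem' := ⟨∅, 0, 0, isCompact_empty, fun f b _ => by simp⟩
  smul_mem' := by
    rintro c u ⟨K, m, M, hK, hu⟩
    refine ⟨K, m, ‖c‖ * M, hK, fun f b hb => ?_⟩
    have h1 := mul_le_mul_of_nonneg_left (hu f b hb) (norm_nonneg c)
    simpa [mul_assoc] using h1

/-- The value of a compactly supported distribution on a smooth function. (It is only ever used
for smooth functions; on other functions it is set to `0`.) -/
def evalDist {L : Type} [Fintype L] (u : CompactDistribution L)
    (f : (L → Spacetime) → ℂ) : ℂ :=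
  open Classical in
  if hf : ContDiff ℝ ∞ f then (u : SmoothFun L →ₗ[ℂ] ℂ) ⟨f, hf⟩ else 0

/-- The function `⨂ h_j : x ↦ ∏ h_j(x_j)`. -/
def tensorFun {L : Type} [Fintype L] (h : L → Config) (x : L → Spacetime) : ℂ :=
  ∏ j, (((h j : Spacetime → ℝ) (x j) : ℝ) : ℂ)

/-! ### Functional derivatives -/

/-- The iterated directional derivative
`∂^{|L|} / ∏_j ∂s_j  F[φ + ∑_j s_j h_j]` at `s = 0`. -/
def dirDeriv (F : Functional) (φ : Config) {L : Type} [Fintype L] (h : L → Config) : ℂ :=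
  open Classical in
  iteratedFDeriv ℝ (Fintype.card L) (fun s : L → ℝ => F (φ + ∑ j, s j • h j)) 0
    (fun a => Pi.single ((Fintype.equivFin L).symm a) (1 : ℝ))

/-- The distribution `u ∈ 𝓔'(𝕄₂^n)` is the `n`-th functional derivative `δⁿF/δφⁿ` at `φ`. -/
def IsFunctionalDeriv (F : Functional) (φ : Config) {n : ℕ}
    (u : CompactDistribution (Fin n)) : Prop :=
  ∀ h : Fin n → Config, evalDist u (tensorFun h) = dirDeriv F φ h

/-- Smooth functionals: smooth along every finite-dimensional family of configurations, with
functional derivatives of every order that are compactly supported distributions. Microcausal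
functionals are smooth functionals with a further restriction on the wave front sets of their
derivatives, which plays no role here. -/
def IsSmooth (F : Functional) : Prop :=
  (∀ (φ : Config) (n : ℕ) (h : Fin n → Config),
    ContDiff ℝ ∞ (fun s : Fin n → ℝ => F (φ + ∑ j, s j • h j))) ∧
  ∀ (φ : Config) (n : ℕ), ∃ u : CompactDistribution (Fin n), IsFunctionalDeriv F φ u

/-- Given functionals `F_i` (`i < n`) and legs `j ∈ L`, the leg `j` being attached to the functional
`F_{v j}`: the distribution `w` on `𝕄₂^L` is the tensor product `⨂_i δ^{n_i}F_i/δφ^{n_i}` at `φ`,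
where `n_i` is the number of legs attached to `F_i` and each derivative acts on its own legs;
equivalently it is `∏_j δ/δφ_{v j}(x_j)` applied to `F_0 ⊗ ⋯ ⊗ F_{n-1}`, at `(φ, …, φ)`. -/
def IsTensorDeriv {n : ℕ} (F : Fin n → Functional) {L : Type} [Fintype L] (v : L → Fin n)
    (φ : Config) (w : CompactDistribution L) : Prop :=
  ∀ h : L → Config, evalDist w (tensorFun h) =
    ∏ i, dirDeriv (F i) φ (fun j : {j : L // v j = i} => h j)

/-! ### Regularised propagators -/

/-- Nonnegative smooth compactly supported functions with integral one. -/
structure IsMollifier (ρ : Spacetime → ℝ) : Prop where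
  smooth : ContDiff ℝ ∞ ρ
  compact : HasCompactSupport ρ
  nonneg : ∀ x, 0 ≤ ρ x
  integral_eq_one : ∫ x, ρ x = 1

/-- `ρ_ε(x) = ε⁻² ρ(x / ε)`. -/
def scaled (ρ : Spacetime → ℝ) (ε : ℝ) (x : Spacetime) : ℝ := (ε⁻¹) ^ 2 * ρ (ε⁻¹ • x)

theorem scaled_contDiff {ρ : Spacetime → ℝ} (hρ : IsMollifier ρ) (ε : ℝ) :
    ContDiff ℝ ∞ (scaled ρ ε) :=
  contDiff_const.mul (hρ.smooth.comp (contDiff_const_smul _))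

theorem scaled_compact {ρ : Spacetime → ℝ} (hρ : IsMollifier ρ) (ε : ℝ) :
    HasCompactSupport (scaled ρ ε) := by
  rcases eq_or_ne ε 0 with rfl | hε
  · have : scaled ρ 0 = 0 := by ext x; simp [scaled]
    rw [this]; exact HasCompactSupport.zero
  · exact (hρ.compact.comp_smul (inv_ne_zero hε)).mul_left

/-- The test function `(x', y') ↦ ρ_ε(x - x') ρ_ε(y - y')` on `𝕄₂ × 𝕄₂`. -/
def mollifierAt {ρ : Spacetime → ℝ} (hρ : IsMollifier ρ) (ε : ℝ) (x y : Spacetime) :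
    𝓓((⊤ : TopologicalSpace.Opens (Spacetime × Spacetime)), ℝ) where
  toFun z := scaled ρ ε (x - z.1) * scaled ρ ε (y - z.2)
  contDiff' := by
    have h := scaled_contDiff hρ ε
    exact (h.comp (contDiff_const.sub contDiff_fst)).mul
      (h.comp (contDiff_const.sub contDiff_snd))
  hasCompactSupport' := by
    have h := scaled_compact hρ ε
    have hx := h.comp_homeomorph (Homeomorph.subLeft x)
    have hy := h.comp_homeomorph (Homeomorph.subLeft y)
    refine HasCompactSupport.intro (hx.isCompact.prod hy.isCompact) fun z hz => ?_
    rw [Set.mem_prod, not_and_or] at hz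
    rcases hz with hz | hz
    · have := image_eq_zero_of_notMem_tsupport hz
      simp only [Function.comp_apply, Homeomorph.coe_subLeft] at this
      simp [this]
    · have := image_eq_zero_of_notMem_tsupport hz
      simp only [Function.comp_apply, Homeomorph.coe_subLeft] at this
      simp [this]
  tsupport_subset' := fun _ _ => trivial

/-- A bidistribution on `𝕄₂`. -/
abbrev Bidistribution : Type :=
  𝓓'((⊤ : TopologicalSpace.Opens (Spacetime × Spacetime)), ℂ)

/-- The regularised propagator `Δ_ε(x, y) = ⟨Δ, ρ_ε(x - ·) ⊗ ρ_ε(y - ·)⟩`, a smooth function. -/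
def regProp (Δ : Bidistribution) {ρ : Spacetime → ℝ} (hρ : IsMollifier ρ) (ε : ℝ)
    (x y : Spacetime) : ℂ :=
  Δ (mollifierAt hρ ε x y)

/-! ### Contractions and time-ordered products -/

/-- Let `κ` be a finite set of edges, the edge `a` going from the factor `src a` to the factor
`tgt a`. The (unrenormalized) contraction
`μ ∘ ∏_a ⟨Δ, δ/δφ_{src a} ⊗ δ/δφ_{tgt a}⟩ (F_0 ⊗ ⋯ ⊗ F_{n-1})`
is well defined at `φ`, with value `z`: the distribution `⨂_i δ^{n_i}F_i/δφ^{n_i}` can be paired with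
`∏_a Δ(x_a, y_a)`, the pairing being the limit of the pairings with the regularised propagators,
independently of the regularisation. -/
def HasContraction (Δ : Bidistribution) {n : ℕ} (F : Fin n → Functional) {κ : Type} [Fintype κ]
    (src tgt : κ → Fin n) (φ : Config) (z : ℂ) : Prop :=
  ∃ w : CompactDistribution (κ ⊕ κ), IsTensorDeriv F (Sum.elim src tgt) φ w ∧
    ∀ (ρ : Spacetime → ℝ) (hρ : IsMollifier ρ),
      Filter.Tendsto
        (fun ε : ℝ => evalDist w fun x => ∏ a, regProp Δ hρ ε (x (Sum.inl a)) (x (Sum.inr a)))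
        (𝓝[>] 0) (𝓝 z)

/-- The value of the contraction (and `0` where it is not well defined). -/
def contraction (Δ : Bidistribution) {n : ℕ} (F : Fin n → Functional) {κ : Type} [Fintype κ]
    (src tgt : κ → Fin n) : Functional := fun φ =>
  open Classical in
  if h : ∃ z, HasContraction Δ F src tgt φ z then h.choose else 0

/-- Contractions of formal power series in `ħ` are well defined if those of all coefficients are. -/
def ContractionDefined (Δ : Bidistribution) {n : ℕ} (F : Fin n → PowerSeries Functional)
    {κ : Type} [Fintype κ] (src tgt : κ → Fin n) : Prop :=
  ∀ (k : Fin n → ℕ) (φ : Config),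
    ∃ z, HasContraction Δ (fun i => PowerSeries.coeff (k i) (F i)) src tgt φ z

/-- Contraction of formal power series in `ħ`, by `ħ`-multilinearity. -/
def contractionSeries (Δ : Bidistribution) {n : ℕ} (F : Fin n → PowerSeries Functional)
    {κ : Type} [Fintype κ] (src tgt : κ → Fin n) : PowerSeries Functional :=
  PowerSeries.mk fun N => ∑ k ∈ Finset.piAntidiag Finset.univ N,
    contraction Δ (fun i => PowerSeries.coeff (k i) (F i)) src tgt

/-- Pairs `i < j` of factors. -/
abbrev Pairs (n : ℕ) : Type := {p : Fin n × Fin n // p.1 < p.2}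

/-- Sum of a power series `∑_j ħ^j a_j` whose terms `a_j` are themselves power series in `ħ`. -/
def hbarSum (a : ℕ → PowerSeries Functional) : PowerSeries Functional :=
  PowerSeries.mk fun N =>
    PowerSeries.coeff N (∑ j ∈ Finset.range (N + 1), PowerSeries.X ^ j * a j)

/-- The time-ordered product
`T_n(F_0 ⊗ ⋯ ⊗ F_{n-1}) = μ ∘ exp(ħ ∑_{i<j} D^{ij}) (F_0 ⊗ ⋯ ⊗ F_{n-1})`, with
`D^{ij} = ⟨Δ, δ/δφ_i ⊗ δ/δφ_j⟩`; the power `(∑_{i<j} D^{ij})^m` is expanded as the sum over all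
words `e` of length `m` in the pairs. -/
def timeOrdered (Δ : Bidistribution) {n : ℕ} (F : Fin n → PowerSeries Functional) :
    PowerSeries Functional :=
  hbarSum fun m => (m.factorial : ℂ)⁻¹ • ∑ e : Fin m → Pairs n,
    contractionSeries Δ F (fun a => (e a).1.1) (fun a => (e a).1.2)

/-- All terms of `T_n(F_0 ⊗ ⋯ ⊗ F_{n-1})` are well defined. -/
def TimeOrderedDefined (Δ : Bidistribution) {n : ℕ} (F : Fin n → PowerSeries Functional) : Prop :=
  ∀ (m : ℕ) (e : Fin m → Pairs n),
    ContractionDefined Δ F (fun a => (e a).1.1) (fun a => (e a).1.2)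

/-- The edges of a term of `(Δ)^{|d|} T_n(δ^{d_0}F_0 ⊗ ⋯ ⊗ δ^{d_{n-1}}F_{n-1}) δ^{|d|}C`: those of a
term of `T_n`, and `d_t` edges from `F_t` to the additional last factor `C` for every `t`. -/
abbrev LegEdges {n : ℕ} (m : ℕ) (d : Fin n → ℕ) : Type := Fin m ⊕ (Σ t : Fin n, Fin (d t))

/-- First end points of the edges. -/
def legSrc {n m : ℕ} (d : Fin n → ℕ) (e : Fin m → Pairs n) : LegEdges m d → Fin (n + 1) :=
  Sum.elim (fun a => (e a).1.1.castSucc) (fun s => s.1.castSucc)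

/-- Second end points of the edges. -/
def legTgt {n m : ℕ} (d : Fin n → ℕ) (e : Fin m → Pairs n) : LegEdges m d → Fin (n + 1) :=
  Sum.elim (fun a => (e a).1.2.castSucc) (fun _ => Fin.last n)

/-- The pairing `(Δ)^{|d|} T_n(δ^{d_0}F_0 ⊗ ⋯ ⊗ δ^{d_{n-1}}F_{n-1}) δ^{|d|}C`, where
`T_n(δ^{d_0}F_0 ⊗ ⋯)` is the time-ordered product of distribution-valued functionals, with
`|d| = ∑ d_t` arguments left open, and the `|d|` propagators join each of these open arguments to
one of the arguments of `δ^{|d|}C`. -/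
def timeOrderedPaired (Δ : Bidistribution) {n : ℕ} (F : Fin n → PowerSeries Functional)
    (d : Fin n → ℕ) (C : PowerSeries Functional) : PowerSeries Functional :=
  hbarSum fun m => (m.factorial : ℂ)⁻¹ • ∑ e : Fin m → Pairs n,
    contractionSeries Δ (Fin.snoc (α := fun _ => PowerSeries Functional) F C)
      (legSrc d e) (legTgt d e)

/-- All terms of `(Δ)^{|d|} T_n(δ^{d_0}F_0 ⊗ ⋯ ⊗ δ^{d_{n-1}}F_{n-1}) δ^{|d|}C` are well defined. -/
def TimeOrderedPairedDefined (Δ : Bidistribution) {n : ℕ} (F : Fin n → PowerSeries Functional)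
    (d : Fin n → ℕ) (C : PowerSeries Functional) : Prop :=
  ∀ (m : ℕ) (e : Fin m → Pairs n),
    ContractionDefined Δ (Fin.snoc (α := fun _ => PowerSeries Functional) F C)
      (legSrc d e) (legTgt d e)

end PAQFT

end

noncomputable section

namespace PAQFT

open MeasureTheory ContinuousLinearMap

/-! ### Derivatives of convolutions and integrals in closed subspaces. -/

section Convolution

variable {V F R : Type*} [NormedAddCommGroup V] [NormedSpace ℝ V]
  [MeasurableSpace V] [BorelSpace V] {μ : Measure V} [SFinite μ] [μ.IsAddLeftInvariant]
  [NormedAddCommGroup F] [NormedSpace ℝ F]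
  [NormedField R] [NormedAlgebra ℝ R] [NormedSpace R F] [IsScalarTower ℝ R F]

/-! A term of the time-ordered product is a word of edges between the factors. Edges go from a
smaller to a larger index, so at the last factor `B * C` only target ends arrive. By the Leibniz
rule the derivative of `B * C` is a sum over subsets `S` of these edges: those in `S` end at `C`,
the others at `B`. A word together with such a subset is the same as a word in the larger alphabet
`Letter l`, whose additional letters are the edges from some `A t` to `C` (`iterDir_prod_sum`,
`sum_moveWord`).

A contraction depends only on the multiset of its edges, so the sum over words of length `m`,
divided by `m!`, behaves like the `m`-th term of the exponential of a sum of commuting variables.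
The binomial and multinomial theorems separate the letters ending at `C`, with multiplicities `d`,
and produce the factors `1 / ∏ d t !` (`sum_words_eq`). If `∑ d t > c`, the term vanishes with the
derivative of `C`. Sorting by powers of `ħ` gives the formula (`hbarSum_sum_range`).

The analytic point is that a contraction has a single value although its distribution is specified
only on tensor products. This needs the density of their span in the smooth functions
(`CompactDistribution.eq_zero_of_tensorFun`): a cut-off reduces to compact support, and a mollified
function is an integral of multiples of tensor products. Well-definedness for `B * C` is then
obtained by adding the distributions of the individual Leibniz terms; the limits add as well. -/

theorem fderiv_convolution_lsmul {f : V → R} {k : V → F} (hf : LocallyIntegrable f μ)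
    (hk : ContDiff ℝ 1 k) (hkc : HasCompactSupport k) :
    fderiv ℝ (convolution f k (lsmul ℝ R) μ) =
      convolution f (fderiv ℝ k) (lsmul ℝ R) μ := by
  ext1 x
  exact (hkc.hasFDerivAt_convolution_right (lsmul ℝ R) hf hk x).fderiv

/-- The scalar field `R` is general because derivatives are put on either factor: on the test
function when the bump is a real weight, and on the bump when the test function is a complex weight.
-/
theorem iteratedFDeriv_convolution_lsmul {f : V → R} {k : V → F} (hf : LocallyIntegrable f μ)
    (hk : ContDiff ℝ ∞ k) (hkc : HasCompactSupport k) (i : ℕ) :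
    iteratedFDeriv ℝ i (convolution f k (lsmul ℝ R) μ) =
      convolution f (iteratedFDeriv ℝ i k) (lsmul ℝ R) μ := by
  induction i with
  | zero =>
    ext1 x
    simp only [iteratedFDeriv_zero_eq_comp, Function.comp_apply, convolution]
    rw [← LinearIsometryEquiv.coe_toContinuousLinearEquiv,
      ← ContinuousLinearEquiv.integral_comp_comm]
    rfl
  | succ i ih =>
    rw [iteratedFDeriv_succ_eq_comp_left, ih, fderiv_convolution_lsmul hf
      (hk.iteratedFDeriv_right (m := 1) (by exact_mod_cast le_top)) (hkc.iteratedFDeriv i),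
      iteratedFDeriv_succ_eq_comp_left]
    ext1 x
    simp only [Function.comp_apply, convolution]
    exact (ContinuousLinearEquiv.integral_comp_comm (μ := μ) (𝕜 := ℝ) (E := V →L[ℝ] V [×i]→L[ℝ] F)
      (F := V [×(i + 1)]→L[ℝ] F) (continuousMultilinearCurryLeftEquiv ℝ (fun _ : Fin (i + 1) => V)
      F).symm.toContinuousLinearEquiv _).symm

end Convolution

/-- The integral commutes with the quotient map by `S`, under which the integrand becomes zero. -/
theorem integral_mem_of_isClosed {X E : Type*} [MeasurableSpace X] {μ : Measure X}
    [NormedAddCommGroup E] [NormedSpace ℝ E] [CompleteSpace E] {S : Submodule ℝ E}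
    (hS : IsClosed (S : Set E)) {φ : X → E} (hφ : Integrable φ μ) (h : ∀ x, φ x ∈ S) :
    ∫ x, φ x ∂μ ∈ S := by
  have : IsClosed (S : Set E) := hS
  have h1 := ContinuousLinearMap.integral_comp_comm S.mkQL hφ
  have h2 : ∀ x, S.mkQL (φ x) = 0 := fun x => (Submodule.Quotient.mk_eq_zero S).2 (h x)
  simp only [h2, integral_zero] at h1
  exact (Submodule.Quotient.mk_eq_zero S).1 h1.symm

/-! ### Jets -/

section Jets

variable {L : Type} [Fintype L]

/-- Multilinear forms on `𝕄₂^L`, with the topology given by the norm. -/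
def MultiForm (L : Type) [Fintype L] (i : ℕ) : Type := (L → Spacetime) [×i]→L[ℝ] ℂ

instance (i : ℕ) : NormedAddCommGroup (MultiForm L i) :=
  inferInstanceAs (NormedAddCommGroup ((L → Spacetime) [×i]→L[ℝ] ℂ))

instance (i : ℕ) : NormedSpace ℝ (MultiForm L i) :=
  inferInstanceAs (NormedSpace ℝ ((L → Spacetime) [×i]→L[ℝ] ℂ))

instance (i : ℕ) : CompleteSpace (MultiForm L i) :=
  inferInstanceAs (CompleteSpace ((L → Spacetime) [×i]→L[ℝ] ℂ))

/-- The derivatives up to order `m` of a smooth function, restricted to a compact set. -/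
def JetSpace (K : TopologicalSpace.Compacts (L → Spacetime)) (m : ℕ) : Type :=
  ∀ i : Fin (m + 1), C(K, MultiForm L i)

instance (K : TopologicalSpace.Compacts (L → Spacetime)) (m : ℕ) :
    NormedAddCommGroup (JetSpace K m) :=
  inferInstanceAs (NormedAddCommGroup (∀ i : Fin (m + 1), C(K, MultiForm L i)))

instance (K : TopologicalSpace.Compacts (L → Spacetime)) (m : ℕ) :
    NormedSpace ℝ (JetSpace K m) :=
  inferInstanceAs (NormedSpace ℝ (∀ i : Fin (m + 1), C(K, MultiForm L i)))

instance (K : TopologicalSpace.Compacts (L → Spacetime)) (m : ℕ) :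
    CompleteSpace (JetSpace K m) :=
  inferInstanceAs (CompleteSpace (∀ i : Fin (m + 1), C(K, MultiForm L i)))

namespace JetSpace

variable {K : TopologicalSpace.Compacts (L → Spacetime)} {m : ℕ}

/-- The derivative of order `i` of a jet. -/
def component (K : TopologicalSpace.Compacts (L → Spacetime)) {m : ℕ} (i : Fin (m + 1)) :
    JetSpace K m →L[ℝ] C(K, MultiForm L i) where
  toFun f := f i
  map_add' _ _ := rfl
  map_smul' _ _ := rfl
  cont := continuous_apply i

theorem ext_component {f g : JetSpace K m} (h : ∀ i x, component K i f x = component K i g x) :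
    f = g :=
  funext fun i => ContinuousMap.ext fun x => h i x

theorem continuous_of_component {X : Type*} [TopologicalSpace X] {f : X → JetSpace K m}
    (h : ∀ i, Continuous fun x => component K i (f x)) : Continuous f :=
  continuous_pi h

theorem norm_le {f : JetSpace K m} {δ : ℝ} (hδ : 0 ≤ δ)
    (h : ∀ i x, ‖component K i f x‖ ≤ δ) : ‖f‖ ≤ δ :=
  (pi_norm_le_iff_of_nonneg (G := fun i : Fin (m + 1) =>
    C(K, MultiForm L i)) hδ).2 fun i =>
      (ContinuousMap.norm_le _ hδ).2 (h i)

theorem norm_component_apply_le (f : JetSpace K m) (i : Fin (m + 1)) (x : K) :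
    ‖component K i f x‖ ≤ ‖f‖ :=
  (ContinuousMap.norm_coe_le_norm (component K i f) x).trans
    (norm_le_pi_norm (G := fun i : Fin (m + 1) => C(K, MultiForm L i)) f i)

end JetSpace

open JetSpace

theorem contDiff_smoothFun (f : SmoothFun L) : ContDiff ℝ ∞ (f : (L → Spacetime) → ℂ) := f.2

/-- The jet of a smooth function. -/
def jet (K : TopologicalSpace.Compacts (L → Spacetime)) (m : ℕ) : SmoothFun L →ₗ[ℝ] JetSpace K m where
  toFun f i := ⟨fun x => iteratedFDeriv ℝ i (f : (L → Spacetime) → ℂ) x,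
    ((contDiff_smoothFun f).continuous_iteratedFDeriv (m := i) (by exact_mod_cast le_top)).comp
      continuous_subtype_val⟩
  map_add' f g := ext_component fun i x =>
    iteratedFDeriv_add_apply ((contDiff_smoothFun f).contDiffAt.of_le (by exact_mod_cast le_top))
      ((contDiff_smoothFun g).contDiffAt.of_le (by exact_mod_cast le_top))
  map_smul' c f := ext_component fun i x =>
    iteratedFDeriv_const_smul_apply
      ((contDiff_smoothFun f).contDiffAt.of_le (by exact_mod_cast le_top))

theorem component_jet (K : TopologicalSpace.Compacts (L → Spacetime)) {m : ℕ} (f : SmoothFun L)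
    (i : Fin (m + 1)) (x : K) :
    component K i (jet K m f) x = iteratedFDeriv ℝ i (f : (L → Spacetime) → ℂ) x := rfl

/-- The product of `|L|` copies of a normalised bump function of one spacetime point. -/
def tensorBump (b : ContDiffBump (0 : Spacetime)) (x : L → Spacetime) : ℝ :=
  ∏ j, b.normed volume (x j)

theorem contDiff_tensorBump (b : ContDiffBump (0 : Spacetime)) :
    ContDiff ℝ ∞ (tensorBump b : (L → Spacetime) → ℝ) := by
  unfold tensorBump
  exact contDiff_prod fun j _ => b.contDiff_normed.comp (contDiff_apply ℝ Spacetime j)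

theorem tensorBump_nonneg (b : ContDiffBump (0 : Spacetime)) (x : L → Spacetime) :
    0 ≤ tensorBump b x := Finset.prod_nonneg fun _ _ => b.nonneg_normed _

theorem integral_tensorBump (b : ContDiffBump (0 : Spacetime)) :
    ∫ x : L → Spacetime, tensorBump b x = 1 := by
  unfold tensorBump
  rw [volume_pi, integral_fintype_prod_eq_prod (𝕜 := ℝ) (fun _ => b.normed volume)]
  simp [b.integral_normed]

theorem support_tensorBump (b : ContDiffBump (0 : Spacetime)) :
    Function.support (tensorBump b : (L → Spacetime) → ℝ) ⊆ Metric.ball 0 b.rOut := by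
  intro x hx
  rw [Function.mem_support, tensorBump, Finset.prod_ne_zero_iff] at hx
  rw [mem_ball_zero_iff, pi_norm_lt_iff b.rOut_pos]
  intro j
  have := hx j (Finset.mem_univ j)
  have h2 : x j ∈ Function.support (b.normed volume) := this
  rw [b.support_normed_eq] at h2
  simpa using h2

theorem hasCompactSupport_tensorBump (b : ContDiffBump (0 : Spacetime)) :
    HasCompactSupport (tensorBump b : (L → Spacetime) → ℝ) :=
  HasCompactSupport.of_support_subset_isCompact (isCompact_closedBall 0 b.rOut)
    ((support_tensorBump b).trans Metric.ball_subset_closedBall)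

/-- The translate of a normalised bump function, as a configuration. -/
def translatedBump (b : ContDiffBump (0 : Spacetime)) (y : Spacetime) : Config :=
  ⟨fun x => b.normed volume (x - y), b.contDiff_normed.comp (contDiff_id.sub contDiff_const)⟩

theorem tensorFun_translatedBump (b : ContDiffBump (0 : Spacetime)) (y x : L → Spacetime) :
    tensorFun (fun j => translatedBump b (y j)) x = (tensorBump b (x - y) : ℂ) := by
  simp [tensorFun, tensorBump, translatedBump]

theorem contDiff_tensorFun (h : L → Config) : ContDiff ℝ ∞ (tensorFun h) := by
  unfold tensorFun
  exact contDiff_prod fun j _ => Complex.ofRealCLM.contDiff.comp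
    ((show ContDiff ℝ ∞ (h j : Spacetime → ℝ) from (h j).2).comp (contDiff_apply ℝ Spacetime j))

/-- The regularisation of a smooth function with compact support by a product of bump functions. -/
def smoothedFun (b : ContDiffBump (0 : Spacetime)) (g : SmoothFun L)
    (hg : HasCompactSupport (g : (L → Spacetime) → ℂ)) : SmoothFun L :=
  ⟨convolution (tensorBump b) (g : (L → Spacetime) → ℂ) (lsmul ℝ ℝ) volume,
    hg.contDiff_convolution_right _ (contDiff_tensorBump b).continuous.locallyIntegrable
      (contDiff_smoothFun g)⟩

/-- Exchanging the factors exhibits the mollified function as a superposition of translated bumps,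
which are tensor products. -/
theorem coe_smoothedFun (b : ContDiffBump (0 : Spacetime)) (g : SmoothFun L)
    (hg : HasCompactSupport (g : (L → Spacetime) → ℂ)) :
    (smoothedFun b g hg : (L → Spacetime) → ℂ) =
      convolution (g : (L → Spacetime) → ℂ) (fun x => (tensorBump b x : ℂ)) (lsmul ℝ ℂ) volume := by
  have : (volume : Measure (L → Spacetime)).IsNegInvariant := Measure.pi.isNegInvariant _
  change convolution (tensorBump b) (g : (L → Spacetime) → ℂ) (lsmul ℝ ℝ) volume = _
  rw [← convolution_flip]
  ext x
  simp only [convolution, lsmul_apply, flip_apply, Complex.real_smul, smul_eq_mul]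
  exact integral_congr_ae (.of_forall fun t => mul_comm _ _)

/-- The jet of the convolution is the Bochner integral over `y` of the jets of `g y` times the bump
translated to `y`. Each of these lies in the closed subspace `S`, hence so does the integral. -/
theorem jet_smoothedFun_mem {K : TopologicalSpace.Compacts (L → Spacetime)} {m : ℕ}
    {S : Submodule ℝ (JetSpace K m)} (hS : IsClosed (S : Set (JetSpace K m)))
    (hT : ∀ (c : ℂ) (h : L → Config), jet K m (c • ⟨tensorFun h, contDiff_tensorFun h⟩) ∈ S)
    (b : ContDiffBump (0 : Spacetime)) (g : SmoothFun L)
    (hg : HasCompactSupport (g : (L → Spacetime) → ℂ)) :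
    jet K m (smoothedFun b g hg) ∈ S := by
  set T : (L → Spacetime) → SmoothFun L := fun y =>
    ⟨tensorFun fun j => translatedBump b (y j), contDiff_tensorFun _⟩ with hTdef
  set k : (L → Spacetime) → ℂ := fun x => (tensorBump b x : ℂ) with hk
  have hks : ContDiff ℝ ∞ k := Complex.ofRealCLM.contDiff.comp (contDiff_tensorBump b)
  have hkc : HasCompactSupport k :=
    (hasCompactSupport_tensorBump b).comp_left (g := ((↑) : ℝ → ℂ)) Complex.ofReal_zero
  have hT1 : ∀ y x (i : ℕ), iteratedFDeriv ℝ i (T y : (L → Spacetime) → ℂ) x =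
      iteratedFDeriv ℝ i k (x - y) := by
    intro y x i
    have : (T y : (L → Spacetime) → ℂ) = fun x => k (x - y) := by
      ext x
      exact tensorFun_translatedBump b y x
    rw [this, iteratedFDeriv_comp_sub]
  set G : (L → Spacetime) → JetSpace K m := fun y =>
    jet K m ((g : (L → Spacetime) → ℂ) y • T y) with hG
  have hGapp : ∀ y i x, component K i (G y) x =
      (g : (L → Spacetime) → ℂ) y • iteratedFDeriv ℝ i k ((x : L → Spacetime) - y) := by
    intro y i x
    rw [hG, ← hT1]
    exact iteratedFDeriv_const_smul_apply
      ((contDiff_smoothFun (T y)).contDiffAt.of_le (by exact_mod_cast le_top))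
  have hGcont : Continuous G := by
    refine continuous_of_component fun i => ?_
    refine ContinuousMap.continuous_of_continuous_uncurry _ ?_
    simp only [hGapp]
    have h1 := (contDiff_smoothFun g).continuous
    have h2 := hks.continuous_iteratedFDeriv (m := (i : ℕ)) (by exact_mod_cast le_top)
    exact (h1.comp continuous_fst).smul
      (h2.comp ((continuous_subtype_val.comp continuous_snd).sub continuous_fst))
  have hGsupp : HasCompactSupport G := by
    refine hg.mono fun y hy => ?_
    contrapose! hy
    rw [Function.notMem_support] at hy ⊢
    rw [hG]
    simp [hy]
  have hGint : Integrable G := hGcont.integrable_of_hasCompactSupport hGsupp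
  have key : jet K m (smoothedFun b g hg) = ∫ y, G y := by
    refine ext_component fun i x => ?_
    have e1 : ∫ y, component K i (G y) = component K i (∫ y, G y) :=
      ContinuousLinearMap.integral_comp_comm (𝕜 := ℝ) (E := JetSpace K m)
        (Fₗ := C(K, MultiForm L i)) (component K i) hGint
    have e2 : Integrable fun y => component K i (G y) :=
      ContinuousLinearMap.integrable_comp (component K i) hGint
    rw [← e1, ContinuousMap.integral_apply e2, component_jet,
      coe_smoothedFun, iteratedFDeriv_convolution_lsmul
        (contDiff_smoothFun g).continuous.locallyIntegrable hks hkc]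
    simp only [hGapp]
    rfl
  rw [key]
  exact integral_mem_of_isClosed hS hGint fun y => hT _ _

/-- Compact support makes the derivatives of `g` uniformly continuous, and convolution with a narrow
bump averages them over a small ball. One radius serves the finitely many orders up to `m`. -/
theorem exists_norm_jet_sub_smoothedFun_le (K : TopologicalSpace.Compacts (L → Spacetime)) (m : ℕ)
    (g : SmoothFun L) (hg : HasCompactSupport (g : (L → Spacetime) → ℂ)) {δ : ℝ} (hδ : 0 < δ) :
    ∃ b : ContDiffBump (0 : Spacetime),
      ‖jet K m (smoothedFun b g hg) - jet K m g‖ ≤ δ := by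
  have huc : ∀ i : Fin (m + 1), ∃ r > 0, ∀ x y : L → Spacetime, dist x y < r →
      dist (iteratedFDeriv ℝ i (g : (L → Spacetime) → ℂ) x)
        (iteratedFDeriv ℝ i (g : (L → Spacetime) → ℂ) y) < δ := by
    intro i
    have h := (hg.iteratedFDeriv (𝕜 := ℝ) i).uniformContinuous_of_continuous
      ((contDiff_smoothFun g).continuous_iteratedFDeriv (m := (i : ℕ)) (by exact_mod_cast le_top))
    obtain ⟨r, hr, h⟩ := Metric.uniformContinuous_iff.1 h δ hδ
    exact ⟨r, hr, fun x y => @h x y⟩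
  choose r hr hrd using huc
  obtain ⟨r0, hr0, hr0'⟩ : ∃ r0 > 0, ∀ i, r0 ≤ r i := by
    refine ⟨Finset.univ.inf' Finset.univ_nonempty r, ?_, fun i => Finset.inf'_le _ (Finset.mem_univ i)⟩
    rw [gt_iff_lt, Finset.lt_inf'_iff]
    exact fun i _ => hr i
  let b : ContDiffBump (0 : Spacetime) := ⟨r0 / 2, r0, by positivity, by linarith⟩
  refine ⟨b, ?_⟩
  refine JetSpace.norm_le hδ.le fun i x => ?_
  rw [map_sub, ContinuousMap.sub_apply, ← dist_eq_norm]
  change dist (iteratedFDeriv ℝ i (smoothedFun b g hg : (L → Spacetime) → ℂ) x)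
    (iteratedFDeriv ℝ i (g : (L → Spacetime) → ℂ) x) ≤ δ
  have e := iteratedFDeriv_convolution_lsmul (μ := (volume : Measure (L → Spacetime)))
    (f := tensorBump b) (contDiff_tensorBump b).continuous.locallyIntegrable
      (contDiff_smoothFun g) hg i
  rw [smoothedFun, e]
  refine dist_convolution_le (R := r0) hδ.le (support_tensorBump b) (tensorBump_nonneg b)
    (integral_tensorBump b)
    (((contDiff_smoothFun g).continuous_iteratedFDeriv (m := (i : ℕ))
      (by exact_mod_cast le_top)).aestronglyMeasurable) fun y hy => ?_
  exact (hrd i _ _ (hy.trans_le (hr0' i))).le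

/-- A compactly supported distribution vanishing on all tensor products vanishes. -/
theorem CompactDistribution.eq_zero_of_tensorFun (u : CompactDistribution L)
    (hu : ∀ h : L → Config, evalDist u (tensorFun h) = 0) : u = 0 := by
  obtain ⟨u, K', m, M, hK, hb⟩ := u
  let K : TopologicalSpace.Compacts (L → Spacetime) := ⟨K', hK⟩
  have hu' : ∀ h : L → Config, u ⟨tensorFun h, contDiff_tensorFun h⟩ = 0 := by
    intro h
    have := hu h
    rwa [evalDist, dif_pos (contDiff_tensorFun h)] at this
  -- The distribution is controlled by the jet on `K`, so its vanishing passes to limits of jets.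
  have hbound : ∀ f : SmoothFun L, ‖u f‖ ≤ |M| * ‖jet K m f‖ := by
    intro f
    refine (hb f ‖jet K m f‖ fun i hi x hx => ?_).trans
      (mul_le_mul_of_nonneg_right (le_abs_self M) (norm_nonneg _))
    exact norm_component_apply_le (jet K m f) ⟨i, by omega⟩ ⟨x, hx⟩
  set S : Submodule ℝ (JetSpace K m) :=
    (((LinearMap.ker u).restrictScalars ℝ).map (jet K m)).topologicalClosure with hSdef
  have hmem : ∀ f : SmoothFun L, jet K m f ∈ S → u f = 0 := by
    intro f hf
    rw [← norm_le_zero_iff]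
    refine le_of_forall_pos_le_add fun δ hδ => ?_
    have hf' : jet K m f ∈ closure
      ((((LinearMap.ker u).restrictScalars ℝ).map (jet K m) : Submodule ℝ _) : Set (JetSpace K m)) :=
      hf
    obtain ⟨_, ⟨g, hg, rfl⟩, hd⟩ := Metric.mem_closure_iff.1 hf' (δ / (|M| + 1)) (by positivity)
    have hg0 : u g = 0 := hg
    have h1 := hbound (f - g)
    rw [map_sub, hg0, sub_zero, map_sub, ← dist_eq_norm] at h1
    calc ‖u f‖ ≤ |M| * dist (jet K m f) (jet K m g) := h1
      _ ≤ (|M| + 1) * (δ / (|M| + 1)) := by gcongr; linarith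
      _ = 0 + δ := by rw [zero_add]; field_simp
  have hcs : ∀ g : SmoothFun L, HasCompactSupport (g : (L → Spacetime) → ℂ) → u g = 0 := by
    intro g hg
    apply hmem
    have hScl : IsClosed (S : Set (JetSpace K m)) := Submodule.isClosed_topologicalClosure _
    rw [← SetLike.mem_coe, ← hScl.closure_eq, Metric.mem_closure_iff]
    intro δ hδ
    obtain ⟨b, hbd⟩ := exists_norm_jet_sub_smoothedFun_le K m g hg (half_pos hδ)
    refine ⟨_, jet_smoothedFun_mem hScl (fun c h => ?_) b g hg, ?_⟩
    · apply Submodule.le_topologicalClosure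
      refine Submodule.mem_map_of_mem ?_
      rw [Submodule.restrictScalars_mem, LinearMap.mem_ker, map_smul, hu', smul_zero]
    · rw [dist_comm, dist_eq_norm]
      linarith
  ext f
  change u f = 0
  -- A cut-off equal to `1` near `K` leaves the jet on `K` unchanged, which reduces the claim to
  -- compact support.
  obtain ⟨R, hR, hKR⟩ := hK.isBounded.subset_ball_lt 0 (0 : L → Spacetime)
  let χ : ContDiffBump (0 : L → Spacetime) := ⟨R, R + 1, hR, by linarith⟩
  let g : SmoothFun L := ⟨fun x => (χ x : ℂ) * (f : (L → Spacetime) → ℂ) x,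
    (Complex.ofRealCLM.contDiff.comp χ.contDiff).mul (contDiff_smoothFun f)⟩
  have hg : HasCompactSupport (g : (L → Spacetime) → ℂ) :=
    (χ.hasCompactSupport.comp_left (g := ((↑) : ℝ → ℂ)) Complex.ofReal_zero).mul_right
  have hjet : jet K m f = jet K m g := by
    refine ext_component fun i x => ?_
    have h1 : (f : (L → Spacetime) → ℂ) =ᶠ[𝓝 (x : L → Spacetime)] (g : (L → Spacetime) → ℂ) := by
      filter_upwards [Metric.isOpen_ball.mem_nhds (hKR x.2)] with y hy
      have : χ y = 1 := χ.one_of_mem_closedBall (Metric.ball_subset_closedBall hy)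
      simp [g, this]
    exact (h1.iteratedFDeriv ℝ i).eq_of_nhds
  have h2 := hbound (f - g)
  rw [map_sub (jet K m), hjet, sub_self, norm_zero, mul_zero, norm_le_zero_iff, map_sub,
    hcs g hg, sub_zero] at h2
  exact h2

end Jets

/-! ### Directional derivatives of functionals -/

/-- Functionals that are smooth along every finite-dimensional affine family of configurations. -/
def IsSmoothAlong (F : Functional) : Prop :=
  ∀ (φ : Config) (n : ℕ) (h : Fin n → Config),
    ContDiff ℝ ∞ (fun s : Fin n → ℝ => F (φ + ∑ j, s j • h j))

theorem IsSmoothAlong.contDiff {F : Functional} (hF : IsSmoothAlong F) (φ : Config) {L : Type}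
    [Fintype L] (h : L → Config) : ContDiff ℝ ∞ (fun s : L → ℝ => F (φ + ∑ j, s j • h j)) := by
  have e := Fintype.equivFin L
  have h1 := (hF φ _ (h ∘ e.symm)).comp
    (contDiff_pi.2 fun a => contDiff_apply ℝ ℝ (e.symm a) :
      ContDiff ℝ ∞ fun (s : L → ℝ) (a : Fin (Fintype.card L)) => s (e.symm a))
  convert! h1 using 1
  ext s
  simp only [Function.comp_apply]
  rw [← e.symm.sum_comp]

/-- The directional derivative of a functional. -/
def dirFun (h : Config) (F : Functional) : Functional := fun φ =>
  deriv (fun t : ℝ => F (φ + t • h)) 0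

theorem dirFun_family {F : Functional} (hF : IsSmoothAlong F) (φ : Config) {L : Type} [Fintype L]
    [DecidableEq L] (h : L → Config) (i : L) (s : L → ℝ) :
    dirFun (h i) F (φ + ∑ j, s j • h j) =
      fderiv ℝ (fun s : L → ℝ => F (φ + ∑ j, s j • h j)) s (Pi.single i 1) := by
  have h1 : DifferentiableAt ℝ (fun s : L → ℝ => F (φ + ∑ j, s j • h j)) s :=
    (hF.contDiff φ h).differentiable (by simp) s
  rw [← h1.lineDeriv_eq_fderiv, lineDeriv, dirFun]
  congr 1
  ext t
  congr 1
  simp only [Pi.add_apply, Pi.smul_apply, add_smul, Finset.sum_add_distrib, smul_assoc, add_assoc]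
  congr 2
  rw [← Finset.smul_sum]
  congr 1
  simp [Pi.single_apply, ite_smul]

theorem dirFun_eq_fderiv {F : Functional} (hF : IsSmoothAlong F) (φ : Config) {L : Type} [Fintype L]
    [DecidableEq L] (h : L → Config) (i : L) :
    dirFun (h i) F φ =
      fderiv ℝ (fun s : L → ℝ => F (φ + ∑ j, s j • h j)) 0 (Pi.single i 1) := by
  rw [← dirFun_family hF]
  simp

/-- The family is enlarged by one parameter, indexed by `none`, in the direction `k`; the new
functional is a partial derivative of the enlarged family. -/
theorem IsSmoothAlong.dirFun {F : Functional} (hF : IsSmoothAlong F) (k : Config) :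
    IsSmoothAlong (dirFun k F) := by
  intro φ n h
  have e : (fun s : Fin n → ℝ => PAQFT.dirFun k F (φ + ∑ j, s j • h j)) = fun s =>
      fderiv ℝ (fun s : Option (Fin n) → ℝ => F (φ + ∑ j, s j • (j.elim k h : Config)))
        (fun j => j.elim 0 s) (Pi.single none 1) := by
    ext s
    rw [← dirFun_family hF]
    simp
  rw [e]
  refine ContDiff.clm_apply (ContDiff.comp (ContDiff.fderiv_right (m := ∞) (hF.contDiff φ _)
    (by simp)) ?_) contDiff_const
  rw [contDiff_pi]
  rintro (_ | j)
  · exact contDiff_const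
  · exact contDiff_apply ℝ ℝ j

/-- Symmetry of the second derivative of the two-parameter family spanned by `h` and `k`, here
indexed by `Bool`. -/
theorem dirFun_comm {F : Functional} (hF : IsSmoothAlong F) (h k : Config) :
    dirFun h (dirFun k F) = dirFun k (dirFun h F) := by
  ext φ
  have key : ∀ (p : Bool → Config) (i j : Bool), dirFun (p i) (dirFun (p j) F) φ =
      fderiv ℝ (fderiv ℝ (fun s : Bool → ℝ => F (φ + ∑ j, s j • p j))) 0
        (Pi.single i 1) (Pi.single j 1) := by
    intro p i j
    rw [dirFun_eq_fderiv (hF.dirFun _)]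
    simp_rw [dirFun_family hF]
    rw [fderiv_clm_apply]
    · simp
    · exact (ContDiff.fderiv_right (m := 1) (hF.contDiff φ p) (by norm_cast)).differentiable
        (by simp) _
    · exact differentiableAt_const _
  have h1 := key (fun b => if b then h else k) true false
  have h2 := key (fun b => if b then h else k) false true
  simp only [if_true, Bool.false_eq_true, if_false] at h1 h2
  rw [h1, h2]
  refine ContDiffAt.isSymmSndFDerivAt (n := ∞) (hF.contDiff φ _).contDiffAt ?_ _ _
  rw [minSmoothness_of_isRCLikeNormedField]
  exact WithTop.coe_le_coe.2 (le_top : (2 : ℕ∞) ≤ ⊤)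

theorem differentiableAt_line {F : Functional} (hF : IsSmoothAlong F) (φ h : Config) :
    DifferentiableAt ℝ (fun t : ℝ => F (φ + t • h)) 0 := by
  have h1 : ContDiff ℝ ∞ fun t : ℝ => F (φ + t • h) := by
    have := (hF.contDiff φ (fun _ : Unit => h)).comp
      (contDiff_pi.2 fun _ => contDiff_id : ContDiff ℝ ∞ fun (t : ℝ) (_ : Unit) => t)
    simpa [Function.comp_def] using this
  exact h1.differentiable (by simp) 0

/-- The algebra of functionals that are smooth along finite-dimensional families. -/
def smoothAlong : Subalgebra ℂ Functional where
  carrier := {F | IsSmoothAlong F}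
  mul_mem' hF hG := fun φ n h => (hF φ n h).mul (hG φ n h)
  add_mem' hF hG := fun φ n h => (hF φ n h).add (hG φ n h)
  algebraMap_mem' _ := fun _ _ _ => contDiff_const

/-- The directional derivative on functionals that are smooth along finite-dimensional families. -/
def dirDerivative (h : Config) (F : smoothAlong) : smoothAlong :=
  ⟨dirFun h F, IsSmoothAlong.dirFun F.2 h⟩

theorem dirDerivative_add (h : Config) (F G : smoothAlong) :
    dirDerivative h (F + G) = dirDerivative h F + dirDerivative h G := by
  ext φ
  exact deriv_fun_add (differentiableAt_line F.2 φ h) (differentiableAt_line G.2 φ h)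

theorem dirDerivative_mul (h : Config) (F G : smoothAlong) :
    dirDerivative h (F * G) = dirDerivative h F * G + F * dirDerivative h G := by
  ext φ
  have := deriv_fun_mul (differentiableAt_line F.2 φ h) (differentiableAt_line G.2 φ h)
  simp only [zero_smul, add_zero] at this
  exact this

/-- Allows folding over a multiset, so that `iterDir` needs no ordering of the directions. -/
instance : LeftCommutative dirDerivative where
  left_comm h k F := Subtype.ext (dirFun_comm F.2 h k)

/-- The iterated derivative `∏_{j ∈ S} ∂_{h_j}` on functionals. -/
def iterDir {L : Type} (h : L → Config) (S : Finset L) (F : smoothAlong) : smoothAlong :=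
  (S.val.map h).foldr dirDerivative F

section iterDir

variable {L : Type} (h : L → Config)

@[simp] theorem iterDir_empty (F : smoothAlong) : iterDir h ∅ F = F := rfl

theorem iterDir_insert [DecidableEq L] {a : L} {S : Finset L} (ha : a ∉ S) (F : smoothAlong) :
    iterDir h (insert a S) F = dirDerivative (h a) (iterDir h S F) := by
  rw [iterDir, Finset.insert_val_of_notMem ha, Multiset.map_cons, Multiset.foldr_cons, iterDir]

theorem iterDir_map {L' : Type} (ι : L' ↪ L) (S : Finset L') (F : smoothAlong) :
    iterDir h (S.map ι) F = iterDir (h ∘ ι) S F := by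
  simp [iterDir, Finset.map_val, Multiset.map_map]

theorem iterDir_add (S : Finset L) (F G : smoothAlong) :
    iterDir h S (F + G) = iterDir h S F + iterDir h S G := by
  classical
  induction S using Finset.induction_on with
  | empty => rfl
  | insert a S ha ih => simp only [iterDir_insert h ha, ih, dirDerivative_add]

theorem iterDir_zero (S : Finset L) : iterDir h S 0 = 0 := by
  have := iterDir_add h S 0 0
  simpa using this

theorem iterDir_sum {ι : Type*} (S : Finset L) (s : Finset ι) (F : ι → smoothAlong) :
    iterDir h S (∑ i ∈ s, F i) = ∑ i ∈ s, iterDir h S (F i) := by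
  classical
  induction s using Finset.induction_on with
  | empty => simp [iterDir_zero]
  | insert a s ha ih => rw [Finset.sum_insert ha, Finset.sum_insert ha, iterDir_add, ih]

/-- The Leibniz rule. -/
theorem iterDir_mul [DecidableEq L] (S : Finset L) (F G : smoothAlong) :
    iterDir h S (F * G) = ∑ T ∈ S.powerset, iterDir h (S \ T) F * iterDir h T G := by
  have hsum : ∀ (a : L) (s : Finset (Finset L)) (X : Finset L → smoothAlong),
      dirDerivative (h a) (∑ T ∈ s, X T) = ∑ T ∈ s, dirDerivative (h a) (X T) := by
    intro a s X
    have := iterDir_sum h {a} s X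
    simpa [iterDir] using this
  induction S using Finset.induction_on with
  | empty => simp
  | insert a S ha ih =>
    -- Subsets of `insert a S` without `a` correspond to the new derivative acting on `F`, those
    -- with `a` to its acting on `G`.
    rw [iterDir_insert h ha, ih, hsum, Finset.sum_powerset_insert ha, ← Finset.sum_add_distrib]
    refine Finset.sum_congr rfl fun T hT => ?_
    have haT : a ∉ T := fun h => ha (Finset.mem_powerset.1 hT h)
    have e1 : insert a S \ T = insert a (S \ T) := Finset.insert_sdiff_of_notMem _ haT
    have e2 : insert a S \ insert a T = S \ T := by
      ext x
      simp only [Finset.mem_sdiff, Finset.mem_insert]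
      by_cases hx : x = a
      · subst hx; simp [ha]
      · simp [hx]
    rw [dirDerivative_mul, e1, e2, iterDir_insert h haT, iterDir_insert h (by simp [ha])]

theorem iteratedFDeriv_family (F : smoothAlong) (φ : Config) [Fintype L] [DecidableEq L] (n : ℕ)
    (i : Fin n → L) (s : L → ℝ) :
    iteratedFDeriv ℝ n (fun s : L → ℝ => (F : Functional) (φ + ∑ j, s j • h j)) s
        (fun a => Pi.single (i a) 1) =
      (iterDir (h ∘ i) Finset.univ F : Functional) (φ + ∑ j, s j • h j) := by
  induction n generalizing s with
  | zero => simp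
  | succ n ih =>
    have hs : ContDiff ℝ ∞ (fun s : L → ℝ => (F : Functional) (φ + ∑ j, s j • h j)) :=
      IsSmoothAlong.contDiff F.2 φ h
    have hd : DifferentiableAt ℝ
        (iteratedFDeriv ℝ n (fun s : L → ℝ => (F : Functional) (φ + ∑ j, s j • h j))) s :=
      (hs.iteratedFDeriv_right (m := 1) (by exact_mod_cast le_top)).differentiable (by simp) s
    rw [iteratedFDeriv_succ_apply_left]
    have e1 := fderiv_continuousMultilinear_apply_const_apply hd
      (fun a : Fin n => Pi.single (i a.succ) (1 : ℝ)) (Pi.single (i 0) 1)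
    refine e1.symm.trans ?_
    simp_rw [ih (fun a => i a.succ)]
    rw [← dirFun_family (iterDir _ _ F).2 φ h (i 0) s]
    have : iterDir (h ∘ i) Finset.univ F =
        dirDerivative (h (i 0)) (iterDir (h ∘ fun a : Fin n => i a.succ) Finset.univ F) := by
      rw [Fin.univ_succ, Finset.cons_eq_insert, iterDir_insert _ (by simp), iterDir_map]
      rfl
    rw [this]
    rfl

/-- Removes the arbitrary enumeration of `L` from `dirDeriv`. -/
theorem dirDeriv_eq_iterDir [Fintype L] (F : smoothAlong) (φ : Config) :
    dirDeriv F φ h = (iterDir h Finset.univ F : Functional) φ := by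
  classical
  have h1 := iteratedFDeriv_family h F φ (Fintype.card L) (Fintype.equivFin L).symm 0
  have h2 : iterDir (h ∘ (Fintype.equivFin L).symm) Finset.univ F = iterDir h Finset.univ F := by
    have := iterDir_map h (Fintype.equivFin L).symm.toEmbedding Finset.univ F
    rw [Finset.map_univ_equiv] at this
    exact this.symm
  rw [h2] at h1
  simp only [Pi.zero_apply, zero_smul, Finset.sum_const_zero, add_zero] at h1
  rw [dirDeriv, ← h1]

/-- Expresses the derivative on the legs of one factor through a finset of all legs, so that later
arguments about legs are equalities of finsets. -/
theorem dirDeriv_subtype [Fintype L] (F : smoothAlong) (φ : Config) (p : L → Prop)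
    [DecidablePred p] :
    dirDeriv F φ (fun j : {j // p j} => h j) =
      (iterDir h (Finset.univ.filter p) F : Functional) φ := by
  rw [dirDeriv_eq_iterDir]
  have := iterDir_map h (Function.Embedding.subtype p) Finset.univ F
  have e : Finset.univ.map (Function.Embedding.subtype p) = Finset.univ.filter p := by
    ext x; simp
  rw [e] at this
  rw [this]
  rfl

theorem iterDir_eq_zero_of_card {F : smoothAlong} {φ : Config} {S : Finset L}
    (hF : IsFunctionalDeriv F φ (0 : CompactDistribution (Fin S.card))) :
    (iterDir h S F : Functional) φ = 0 := by
  have h1 := hF (fun a => h (S.equivFin.symm a))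
  rw [dirDeriv_eq_iterDir] at h1
  have e := iterDir_map h (S.equivFin.symm.toEmbedding.trans (Function.Embedding.subtype _))
    Finset.univ F
  have e2 : Finset.univ.map (S.equivFin.symm.toEmbedding.trans (Function.Embedding.subtype _)) =
      S := by
    rw [← Finset.map_map, Finset.map_univ_equiv]
    ext x; simp
  rw [e2] at e
  rw [e]
  refine h1.symm.trans ?_
  simp [evalDist]

end iterDir

/-! ### Contractions -/

section EvalDist

variable {L : Type} [Fintype L]

theorem evalDist_zero (f : (L → Spacetime) → ℂ) : evalDist (0 : CompactDistribution L) f = 0 := by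
  simp [evalDist]

theorem evalDist_add (u v : CompactDistribution L) (f : (L → Spacetime) → ℂ) :
    evalDist (u + v) f = evalDist u f + evalDist v f := by
  unfold evalDist
  split_ifs <;> simp

theorem evalDist_sum {ι : Type*} (s : Finset ι) (u : ι → CompactDistribution L)
    (f : (L → Spacetime) → ℂ) : evalDist (∑ i ∈ s, u i) f = ∑ i ∈ s, evalDist (u i) f := by
  classical
  induction s using Finset.induction_on with
  | empty => exact evalDist_zero f
  | insert a s ha ih => rw [Finset.sum_insert ha, Finset.sum_insert ha, evalDist_add, ih]

theorem evalDist_sub (u v : CompactDistribution L) (f : (L → Spacetime) → ℂ) :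
    evalDist (u - v) f = evalDist u f - evalDist v f := by
  unfold evalDist
  split_ifs <;> simp

theorem IsTensorDeriv.unique {n : ℕ} {F : Fin n → Functional} {v : L → Fin n} {φ : Config}
    {w w' : CompactDistribution L} (hw : IsTensorDeriv F v φ w) (hw' : IsTensorDeriv F v φ w') :
    w = w' := by
  refine sub_eq_zero.1 (CompactDistribution.eq_zero_of_tensorFun _ fun h => ?_)
  rw [evalDist_sub, hw h, hw' h, sub_self]

end EvalDist

theorem exists_isMollifier : ∃ ρ : Spacetime → ℝ, IsMollifier ρ := by
  let b : ContDiffBump (0 : Spacetime) := ⟨1, 2, one_pos, one_lt_two⟩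
  exact ⟨b.normed MeasureTheory.volume, b.contDiff_normed, b.hasCompactSupport_normed,
    b.nonneg_normed, b.integral_normed⟩

section HasContraction

variable {Δ : Bidistribution} {n : ℕ} {F : Fin n → Functional} {κ κ' : Type} [Fintype κ]
  [Fintype κ'] {src tgt : κ → Fin n} {φ : Config} {z z' : ℂ}

theorem HasContraction.unique (h : HasContraction Δ F src tgt φ z)
    (h' : HasContraction Δ F src tgt φ z') : z = z' := by
  obtain ⟨w, hw, hz⟩ := h
  obtain ⟨w', hw', hz'⟩ := h'
  obtain rfl := hw.unique hw'
  obtain ⟨ρ, hρ⟩ := exists_isMollifier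
  exact tendsto_nhds_unique (hz ρ hρ) (hz' ρ hρ)

/-- Uniqueness of the distribution, and then of the limit for one mollifier, identifies the chosen
value with any other. -/
theorem HasContraction.contraction_eq (h : HasContraction Δ F src tgt φ z) :
    contraction Δ F src tgt φ = z := by
  have hex : ∃ z, HasContraction Δ F src tgt φ z := ⟨z, h⟩
  rw [contraction, dif_pos hex]
  exact hex.choose_spec.unique h

/-- One vanishing factor makes the tensor product vanish, so the zero distribution serves whatever
the other factors are. -/
theorem HasContraction.zero (i : Fin n)
    (hi : ∀ h : κ ⊕ κ → Config,
      dirDeriv (F i) φ (fun j : {j // Sum.elim src tgt j = i} => h j) = 0) :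
    HasContraction Δ F src tgt φ 0 := by
  refine ⟨0, fun h => ?_, fun ρ hρ => ?_⟩
  · rw [evalDist_zero, Finset.prod_eq_zero (Finset.mem_univ i) (hi h)]
  · simp only [evalDist_zero]
    exact tendsto_const_nhds

end HasContraction

/-! ### Relabelling edges -/

section Relabel

variable {L L' : Type} [Fintype L] [Fintype L']

/-- Relabelling of the arguments. -/
def relabel (σ : L ≃ L') : (L → Spacetime) ≃ₗᵢ[ℝ] (L' → Spacetime) where
  toLinearEquiv := LinearEquiv.funCongrLeft ℝ Spacetime σ.symm
  norm_map' x := by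
    change ‖x ∘ σ.symm‖ = ‖x‖
    refine le_antisymm ((pi_norm_le_iff_of_nonneg (norm_nonneg _)).2 fun j => norm_le_pi_norm x _)
      ((pi_norm_le_iff_of_nonneg (norm_nonneg _)).2 fun j => ?_)
    simpa using norm_le_pi_norm (x ∘ σ.symm) (σ j)

theorem relabel_apply (σ : L ≃ L') (x : L → Spacetime) (j : L') :
    relabel σ x j = x (σ.symm j) := rfl

/-- Relabelling of the arguments of a smooth function. -/
def SmoothFun.relabel (σ : L ≃ L') : SmoothFun L' →ₗ[ℂ] SmoothFun L where
  toFun f := ⟨fun x => (f : (L' → Spacetime) → ℂ) (PAQFT.relabel σ x),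
    (contDiff_smoothFun f).comp (PAQFT.relabel σ).contDiff⟩
  map_add' _ _ := rfl
  map_smul' _ _ := rfl

/-- Relabelling of the arguments of a distribution. -/
def CompactDistribution.relabel (σ : L ≃ L') (w : CompactDistribution L) :
    CompactDistribution L' :=
  ⟨(w : SmoothFun L →ₗ[ℂ] ℂ) ∘ₗ SmoothFun.relabel σ, by
    obtain ⟨w, K, m, M, hK, hw⟩ := w
    refine ⟨PAQFT.relabel σ '' K, m, M, hK.image (PAQFT.relabel σ).continuous, fun f b hb => ?_⟩
    refine hw _ b fun i hi x hx => ?_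
    refine le_trans (le_of_eq ?_) (hb i hi _ ⟨x, hx, rfl⟩)
    exact (PAQFT.relabel σ).norm_iteratedFDeriv_comp_right (f : (L' → Spacetime) → ℂ) x i⟩

theorem evalDist_relabel (σ : L ≃ L') (w : CompactDistribution L) (f : (L' → Spacetime) → ℂ) :
    evalDist (CompactDistribution.relabel σ w) f = evalDist w (fun x => f (relabel σ x)) := by
  by_cases hf : ContDiff ℝ ∞ f
  · have hf' : ContDiff ℝ ∞ (fun x => f (relabel σ x)) := hf.comp (relabel σ).contDiff
    rw [evalDist, evalDist, dif_pos hf, dif_pos hf']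
    rfl
  -- Relabelling is invertible, so both sides take the default value `0` together.
  · have hf' : ¬ ContDiff ℝ ∞ (fun x => f (relabel σ x)) := fun h => hf <| by
      have := h.comp (relabel σ).symm.contDiff
      simpa [Function.comp_def] using this
    rw [evalDist, evalDist, dif_neg hf, dif_neg hf']

/-- The legs at a factor get enumerated differently after relabelling; smoothness enters through the
symmetry of the derivatives. -/
theorem IsTensorDeriv.relabel {n : ℕ} {F : Fin n → Functional} (hF : ∀ i, IsSmoothAlong (F i))
    (σ : L ≃ L') {v : L' → Fin n} {φ : Config} {w : CompactDistribution L}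
    (hw : IsTensorDeriv F (v ∘ σ) φ w) : IsTensorDeriv F v φ (CompactDistribution.relabel σ w) := by
  intro h
  have e : (fun x => tensorFun h (PAQFT.relabel σ x)) = tensorFun (h ∘ σ) := by
    ext x
    simp only [tensorFun, relabel_apply, Function.comp_apply]
    rw [← σ.prod_comp]
    simp
  rw [evalDist_relabel, e, hw]
  refine Finset.prod_congr rfl fun i _ => ?_
  have h1 := dirDeriv_subtype (h ∘ σ) ⟨F i, hF i⟩ φ (fun j => (v ∘ σ) j = i)
  have h2 := dirDeriv_subtype h ⟨F i, hF i⟩ φ (fun j => v j = i)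
  refine h1.trans (Eq.trans ?_ h2.symm)
  have h3 := iterDir_map h σ.toEmbedding (Finset.univ.filter fun j => (v ∘ σ) j = i) ⟨F i, hF i⟩
  have h4 : (Finset.univ.filter fun j => (v ∘ σ) j = i).map σ.toEmbedding =
      Finset.univ.filter fun j => v j = i := by
    ext j
    simp only [Finset.mem_map_equiv, Finset.mem_filter, Finset.mem_univ, true_and,
      Function.comp_apply, Equiv.apply_symm_apply]
  rw [h4] at h3
  rw [h3]
  rfl

variable {Δ : Bidistribution} {n : ℕ} {F : Fin n → Functional} {κ κ' : Type} [Fintype κ]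
  [Fintype κ'] {src tgt : κ' → Fin n} {φ : Config} {z : ℂ}

theorem HasContraction.relabel (hF : ∀ i, IsSmoothAlong (F i)) (σ : κ ≃ κ')
    (h : HasContraction Δ F (src ∘ σ) (tgt ∘ σ) φ z) : HasContraction Δ F src tgt φ z := by
  obtain ⟨w, hw, hz⟩ := h
  have e : Sum.elim (src ∘ σ) (tgt ∘ σ) = Sum.elim src tgt ∘ (σ.sumCongr σ) := by
    ext (j | j) <;> rfl
  rw [e] at hw
  refine ⟨CompactDistribution.relabel (σ.sumCongr σ) w, hw.relabel hF, fun ρ hρ => ?_⟩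
  refine (hz ρ hρ).congr fun ε => ?_
  rw [evalDist_relabel]
  congr 1
  ext x
  rw [← σ.prod_comp]
  simp [relabel_apply]

theorem hasContraction_comp_equiv (hF : ∀ i, IsSmoothAlong (F i)) (σ : κ ≃ κ') :
    HasContraction Δ F (src ∘ σ) (tgt ∘ σ) φ z ↔ HasContraction Δ F src tgt φ z := by
  refine ⟨.relabel hF σ, fun h => .relabel hF σ.symm ?_⟩
  simpa [Function.comp_assoc] using h

/-- The two predicates coincide, so the classical choices do too, including the default value where
nothing is defined. -/
theorem contraction_comp_equiv (hF : ∀ i, IsSmoothAlong (F i)) (σ : κ ≃ κ') :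
    contraction Δ F (src ∘ σ) (tgt ∘ σ) = contraction Δ F src tgt := by
  ext φ
  have : HasContraction Δ F (src ∘ σ) (tgt ∘ σ) φ = HasContraction Δ F src tgt φ :=
    funext fun z => propext (hasContraction_comp_equiv hF σ)
  unfold contraction
  rw [this]

end Relabel

/-! ### Contractions of products -/

section Product

variable {l : ℕ} {κ : Type} [Fintype κ] [DecidableEq κ]

/-- The end points of edges, when those edges in `S` are moved to an additional last factor. -/
def moveTgt (tgt : κ → Fin (l + 1)) (S : Finset κ) (a : κ) : Fin (l + 2) :=
  if a ∈ S then Fin.last (l + 1) else (tgt a).castSucc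

/-- By `hsrc` the legs at the last factor are target ends only, and the Leibniz rule distributes
them: those of `S` to `C i`, the rest to `B i`. -/
theorem iterDir_prod_sum {ι : Type} (s : Finset ι) (A : Fin l → smoothAlong)
    (B C : ι → smoothAlong) {src tgt : κ → Fin (l + 1)} (hsrc : ∀ a, src a ≠ Fin.last l)
    (φ : Config) (h : κ ⊕ κ → Config) :
    ∏ i, dirDeriv (Fin.snoc (α := fun _ => Functional) (fun t => (A t : Functional))
        ((∑ i ∈ s, B i * C i : smoothAlong) : Functional) i) φ
        (fun j : {j : κ ⊕ κ // Sum.elim src tgt j = i} => h j) =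
      ∑ i ∈ s, ∑ S ∈ (Finset.univ.filter fun a => tgt a = Fin.last l).powerset,
        ∏ q, dirDeriv (Fin.snoc (α := fun _ => Functional)
          (Fin.snoc (α := fun _ => Functional) (fun t => (A t : Functional)) (B i)) (C i) q) φ
          (fun j : {j : κ ⊕ κ // Sum.elim (Fin.castSucc ∘ src) (moveTgt tgt S) j = q} => h j) := by
  set P := Finset.univ.filter fun a => tgt a = Fin.last l with hP
  have hL : (Finset.univ.filter fun j => Sum.elim src tgt j = Fin.last l) =
      P.map Function.Embedding.inr := by
    ext (a | a) <;> simp [hP, hsrc]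
  simp only [Fin.prod_univ_castSucc, Fin.snoc_castSucc, Fin.snoc_last, dirDeriv_subtype]
  rw [hL, iterDir_map, iterDir_sum]
  simp only [iterDir_mul]
  rw [AddSubmonoidClass.coe_finsetSum, Finset.sum_apply, Finset.mul_sum]
  refine Finset.sum_congr rfl fun i _ => ?_
  rw [AddSubmonoidClass.coe_finsetSum, Finset.sum_apply, Finset.mul_sum]
  refine Finset.sum_congr rfl fun S hS => ?_
  rw [Finset.mem_powerset] at hS
  have hS' : ∀ a ∈ S, tgt a = Fin.last l := fun a ha => by simpa [hP] using hS ha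
  -- The legs at each factor after the move: unchanged at the `A t`, `P \ S` at `B i`, and `S` at `C
  -- i`.
  have h1 : ∀ t : Fin l, (Finset.univ.filter fun j =>
      Sum.elim (Fin.castSucc ∘ src) (moveTgt tgt S) j = t.castSucc.castSucc) =
        Finset.univ.filter fun j => Sum.elim src tgt j = t.castSucc := by
    intro t
    ext (a | a)
    · simp
    · by_cases ha : a ∈ S
      · simp [moveTgt, ha, hS' a ha, Fin.ext_iff]; omega
      · simp [moveTgt, ha]
  have h2 : (Finset.univ.filter fun j =>
      Sum.elim (Fin.castSucc ∘ src) (moveTgt tgt S) j = (Fin.last l).castSucc) =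
        (P \ S).map Function.Embedding.inr := by
    ext (a | a)
    · simpa using hsrc a
    · by_cases ha : a ∈ S
      · simp [moveTgt, ha, Fin.ext_iff]
      · simp [moveTgt, ha, hP]
  have h3 : (Finset.univ.filter fun j =>
      Sum.elim (Fin.castSucc ∘ src) (moveTgt tgt S) j = Fin.last (l + 1)) =
        S.map Function.Embedding.inr := by
    ext (a | a)
    · simp [Fin.ext_iff]; omega
    · by_cases ha : a ∈ S
      · simp [moveTgt, ha]
      · simp [moveTgt, ha, Fin.ext_iff]; omega
  simp only [h1, h2, h3, iterDir_map, mul_assoc]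
  rfl

/-- Both defining conditions are additive, so the sum of the distributions of the Leibniz terms is a
witness. -/
theorem HasContraction.sum_mul {Δ : Bidistribution} {ι : Type} (s : Finset ι)
    (A : Fin l → smoothAlong) (B C : ι → smoothAlong) {src tgt : κ → Fin (l + 1)}
    (hsrc : ∀ a, src a ≠ Fin.last l) {φ : Config} {z : ι → Finset κ → ℂ}
    (hz : ∀ i ∈ s, ∀ S ∈ (Finset.univ.filter fun a => tgt a = Fin.last l).powerset,
      HasContraction Δ (Fin.snoc (α := fun _ => Functional)
          (Fin.snoc (α := fun _ => Functional) (fun t => (A t : Functional)) (B i)) (C i))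
        (Fin.castSucc ∘ src) (moveTgt tgt S) φ (z i S)) :
    HasContraction Δ (Fin.snoc (α := fun _ => Functional) (fun t => (A t : Functional))
        ((∑ i ∈ s, B i * C i : smoothAlong) : Functional)) src tgt φ
      (∑ i ∈ s, ∑ S ∈ (Finset.univ.filter fun a => tgt a = Fin.last l).powerset, z i S) := by
  set P := (Finset.univ.filter fun a => tgt a = Fin.last l).powerset with hP
  have hw : ∀ (i : ι) (S : Finset κ), ∃ w : CompactDistribution (κ ⊕ κ), i ∈ s → S ∈ P →
      IsTensorDeriv (Fin.snoc (α := fun _ => Functional)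
        (Fin.snoc (α := fun _ => Functional) (fun t => (A t : Functional)) (B i)) (C i))
        (Sum.elim (Fin.castSucc ∘ src) (moveTgt tgt S)) φ w ∧
      ∀ (ρ : Spacetime → ℝ) (hρ : IsMollifier ρ), Filter.Tendsto
        (fun ε : ℝ => evalDist w fun x => ∏ a, regProp Δ hρ ε (x (Sum.inl a)) (x (Sum.inr a)))
        (𝓝[>] 0) (𝓝 (z i S)) := by
    intro i S
    by_cases h : i ∈ s ∧ S ∈ P
    · obtain ⟨w, h1, h2⟩ := hz i h.1 S h.2
      exact ⟨w, fun _ _ => ⟨h1, h2⟩⟩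
    · exact ⟨0, fun h1 h2 => (h ⟨h1, h2⟩).elim⟩
  choose w hw using hw
  refine ⟨∑ i ∈ s, ∑ S ∈ P, w i S, fun h => ?_, fun ρ hρ => ?_⟩
  · rw [iterDir_prod_sum s A B C hsrc, evalDist_sum]
    refine Finset.sum_congr rfl fun i hi => ?_
    rw [evalDist_sum]
    exact Finset.sum_congr rfl fun S hS => (hw i S hi hS).1 h
  · simp only [evalDist_sum]
    exact tendsto_finsetSum _ fun i hi => tendsto_finsetSum _ fun S hS => (hw i S hi hS).2 ρ hρ

end Product

/-! ### Sums over words -/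

section Words

/-- Equal multisets of values mean fibres of equal size; bijections of the fibres are glued. -/
theorem exists_equiv_of_map_eq {α β Z : Type*} [Fintype α] [Fintype β] {f : α → Z} {g : β → Z}
    (h : Finset.univ.val.map f = Finset.univ.val.map g) : ∃ e : α ≃ β, g ∘ e = f := by
  classical
  have hc : ∀ z, Nonempty ({a // f a = z} ≃ {b // g b = z}) := by
    intro z
    refine ⟨Fintype.equivOfCardEq ?_⟩
    have := congrArg (Multiset.count z) h
    rw [Multiset.count_map, Multiset.count_map] at this
    rw [Fintype.card_subtype, Fintype.card_subtype]
    simpa [Finset.card_def, Finset.filter_val, eq_comm] using this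
  have e := fun z => (hc z).some
  exact ⟨Equiv.ofFiberEquiv e, funext fun a => Equiv.ofFiberEquiv_map e a⟩

variable {X Y M : Type} [Fintype X] [Fintype Y] [DecidableEq Y]

/-- The linear extension of a function of multisets to polynomials. -/
def multisetLift {Z : Type} [AddCommGroup M] [Module ℂ M] (Φ : Multiset Z → M) :
    MvPolynomial Z ℂ →ₗ[ℂ] M :=
  (MvPolynomial.basisMonomials Z ℂ).constr ℂ fun s => Φ (Finsupp.toMultiset s)

theorem multisetLift_prod {Z : Type} [AddCommGroup M] [Module ℂ M] (Φ : Multiset Z → M)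
    (S : Multiset Z) : multisetLift Φ (S.map MvPolynomial.X).prod = Φ S := by
  classical
  have h : (S.map (MvPolynomial.X (R := ℂ))).prod =
      MvPolynomial.basisMonomials Z ℂ (Multiset.toFinsupp S) := by
    rw [MvPolynomial.coe_basisMonomials]
    induction S using Multiset.induction_on with
    | empty => simp
    | cons a S ih =>
      rw [Multiset.map_cons, Multiset.prod_cons, ih, MvPolynomial.X, MvPolynomial.monomial_mul,
        one_mul, ← Multiset.singleton_add, map_add, Multiset.toFinsupp_singleton]
  rw [h, multisetLift, Module.Basis.constr_basis, Multiset.toFinsupp_toMultiset]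

/-- An identity between polynomials in commuting variables, namely the expansion of `(∑ x + ∑ y) ^ m
/ m!`, carried over to `M` by `multisetLift`. Only linearity is used there, so `M` needs no product.
-/
theorem sum_words_eq [AddCommGroup M] [Module ℂ M] (Φ : Multiset (X ⊕ Y) → M) (m : ℕ) :
    (m.factorial : ℂ)⁻¹ • ∑ g : Fin m → X ⊕ Y, Φ (Finset.univ.val.map g) =
      ∑ i ∈ Finset.range (m + 1), ∑ d ∈ Finset.piAntidiag (Finset.univ : Finset Y) i,
        (∏ t, ((d t).factorial : ℂ))⁻¹ • ((m - i).factorial : ℂ)⁻¹ •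
          ∑ e : Fin (m - i) → X, Φ ((Finset.univ.val.map e).map Sum.inl +
            ∑ t, Multiset.replicate (d t) (Sum.inr t)) := by
  have hpow : ∀ {Z : Type} [Fintype Z] (ι : Z → X ⊕ Y) (m : ℕ),
      (∑ z, MvPolynomial.X (R := ℂ) (ι z)) ^ m =
        ∑ g : Fin m → Z, (((Finset.univ.val.map g).map ι).map MvPolynomial.X).prod := by
    intro Z _ ι m
    rw [Fintype.sum_pow]
    refine Finset.sum_congr rfl fun g _ => ?_
    rw [Multiset.map_map, Multiset.map_map]
    rfl
  have hsum : (m.factorial : ℂ)⁻¹ • (∑ z : X ⊕ Y, MvPolynomial.X (R := ℂ) z) ^ m =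
      ∑ i ∈ Finset.range (m + 1), ∑ d ∈ Finset.piAntidiag (Finset.univ : Finset Y) i,
        (∏ t, ((d t).factorial : ℂ))⁻¹ • ((m - i).factorial : ℂ)⁻¹ •
          ∑ e : Fin (m - i) → X, (((Finset.univ.val.map e).map Sum.inl +
            ∑ t, Multiset.replicate (d t) (Sum.inr t)).map MvPolynomial.X).prod := by
    rw [Fintype.sum_sum_type, add_comm, add_pow, Finset.smul_sum]
    refine Finset.sum_congr rfl fun i hi => ?_
    have hi' : i ≤ m := Nat.lt_succ_iff.1 (Finset.mem_range.1 hi)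
    rw [Finset.sum_pow_eq_sum_piAntidiag, Finset.sum_mul, Finset.sum_mul, Finset.smul_sum]
    refine Finset.sum_congr rfl fun d hd => ?_
    have hd' : ∑ t, d t = i := (Finset.mem_piAntidiag.1 hd).1
    have e1 : ∀ e : Fin (m - i) → X, (((Finset.univ.val.map e).map Sum.inl +
        ∑ t, Multiset.replicate (d t) (Sum.inr t)).map (MvPolynomial.X (R := ℂ))).prod =
        (((Finset.univ.val.map e).map Sum.inl).map (MvPolynomial.X (R := ℂ))).prod *
          ∏ t, MvPolynomial.X (Sum.inr t) ^ d t := by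
      intro e
      rw [Multiset.map_add, Multiset.prod_add]
      congr 1
      rw [← Multiset.coe_mapAddMonoidHom, map_sum, Multiset.prod_sum]
      simp
    simp only [e1]
    rw [← Finset.sum_mul, ← hpow Sum.inl, smul_smul]
    have e2 : ((Nat.multinomial Finset.univ d : ℕ) : MvPolynomial (X ⊕ Y) ℂ) *
        (∏ t, MvPolynomial.X (Sum.inr t) ^ d t) * (∑ z, MvPolynomial.X (Sum.inl z)) ^ (m - i) *
        ((m.choose i : ℕ) : MvPolynomial (X ⊕ Y) ℂ) =
        ((Nat.multinomial Finset.univ d * m.choose i : ℕ) : ℂ) •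
        ((∑ z, MvPolynomial.X (Sum.inl z)) ^ (m - i) * ∏ t, MvPolynomial.X (Sum.inr t) ^ d t) := by
      rw [Algebra.smul_def, map_natCast]
      push_cast
      ring
    rw [e2, smul_smul]
    congr 1
    have h1 := Nat.multinomial_spec Finset.univ d
    have h2 := Nat.choose_mul_factorial_mul_factorial hi'
    rw [hd'] at h1
    rw [← h1] at h2
    -- The binomial and multinomial coefficients together turn `1 / m!` into `1 / ((m - i)! ∏ d t
    -- !)`.
    have h3 : (m.factorial : ℂ) = (m.choose i : ℂ) *
        ((∏ t, ((d t).factorial : ℂ)) * Nat.multinomial Finset.univ d) * ((m - i).factorial : ℂ) := by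
      rw [← h2]
      push_cast
      ring
    have h4 : (m.factorial : ℂ) ≠ 0 := by exact_mod_cast m.factorial_ne_zero
    have h5 : ((m - i).factorial : ℂ) ≠ 0 := by exact_mod_cast (m - i).factorial_ne_zero
    have h6 : (∏ t, ((d t).factorial : ℂ)) ≠ 0 :=
      Finset.prod_ne_zero_iff.2 fun t _ => by exact_mod_cast (d t).factorial_ne_zero
    field_simp
    rw [h3]
    push_cast
    ring
  have h := congrArg (multisetLift Φ) hsum
  have hz := hpow (Z := X ⊕ Y) id m
  simp only [id_eq, Multiset.map_id'] at hz
  rw [hz] at h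
  simpa only [map_sum, map_smul, multisetLift_prod] using h

end Words

/-! ### Contractions of power series -/

section Series

variable {Δ : Bidistribution} {n : ℕ} {F : Fin n → PowerSeries Functional} {κ κ' : Type}
  [Fintype κ] [Fintype κ']

theorem contractionSeries_comp_equiv (hF : ∀ i k, IsSmoothAlong (PowerSeries.coeff k (F i)))
    (σ : κ ≃ κ') {src tgt : κ' → Fin n} :
    contractionSeries Δ F (src ∘ σ) (tgt ∘ σ) = contractionSeries Δ F src tgt := by
  unfold contractionSeries
  congr 1
  ext1 N
  exact Finset.sum_congr rfl fun k _ => contraction_comp_equiv (fun i => hF i (k i)) σ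

theorem contractionDefined_comp_equiv (hF : ∀ i k, IsSmoothAlong (PowerSeries.coeff k (F i)))
    (σ : κ ≃ κ') {src tgt : κ' → Fin n} :
    ContractionDefined Δ F (src ∘ σ) (tgt ∘ σ) ↔ ContractionDefined Δ F src tgt := by
  refine forall_congr' fun k => forall_congr' fun φ => exists_congr fun z => ?_
  exact hasContraction_comp_equiv (fun i => hF i (k i)) σ

/-- Words with the same letters differ by a bijection of their positions, to which contractions are
insensitive. -/
theorem contractionSeries_eq_of_map_eq (hF : ∀ i k, IsSmoothAlong (PowerSeries.coeff k (F i)))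
    {Z : Type} (src tgt : Z → Fin n) {g : κ → Z} {g' : κ' → Z}
    (h : Finset.univ.val.map g = Finset.univ.val.map g') :
    contractionSeries Δ F (src ∘ g) (tgt ∘ g) = contractionSeries Δ F (src ∘ g') (tgt ∘ g') := by
  obtain ⟨e, rfl⟩ := exists_equiv_of_map_eq h
  exact contractionSeries_comp_equiv hF e (src := src ∘ g') (tgt := tgt ∘ g')

theorem contractionDefined_of_map_eq (hF : ∀ i k, IsSmoothAlong (PowerSeries.coeff k (F i)))
    {Z : Type} (src tgt : Z → Fin n) {g : κ → Z} {g' : κ' → Z}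
    (h : Finset.univ.val.map g = Finset.univ.val.map g')
    (hg : ContractionDefined Δ F (src ∘ g') (tgt ∘ g')) :
    ContractionDefined Δ F (src ∘ g) (tgt ∘ g) := by
  obtain ⟨e, rfl⟩ := exists_equiv_of_map_eq h
  exact (contractionDefined_comp_equiv hF e (src := src ∘ g') (tgt := tgt ∘ g')).2 hg

theorem contractionSeries_eq_zero {src tgt : κ → Fin n}
    (h : ∀ (k : Fin n → ℕ) (φ : Config), HasContraction Δ (fun i => PowerSeries.coeff (k i) (F i)) src tgt φ 0) :
    contractionSeries Δ F src tgt = 0 := by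
  ext1 N
  rw [contractionSeries, PowerSeries.coeff_mk, map_zero]
  exact Finset.sum_eq_zero fun k _ => funext fun φ => (h k φ).contraction_eq

theorem coeff_hbarSum (a : ℕ → PowerSeries Functional) (N : ℕ) :
    PowerSeries.coeff N (hbarSum a) =
      ∑ j ∈ Finset.range (N + 1), PowerSeries.coeff (N - j) (a j) := by
  rw [hbarSum, PowerSeries.coeff_mk, map_sum]
  refine Finset.sum_congr rfl fun j hj => ?_
  rw [PowerSeries.coeff_X_pow_mul', if_pos (Nat.lt_succ_iff.1 (Finset.mem_range.1 hj))]

theorem hbarSum_congr {a b : ℕ → PowerSeries Functional} (h : ∀ m, a m = b m) :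
    hbarSum a = hbarSum b := by rw [funext h]

/-- Splitting `ħ ^ m` as `ħ ^ i * ħ ^ (m - i)` and exchanging the sums over the triangle; `hG` then
truncates at `c`. -/
theorem hbarSum_sum_range {c : ℕ} (G : ℕ → ℕ → PowerSeries Functional)
    (hG : ∀ i > c, ∀ m, G i m = 0) :
    hbarSum (fun m => ∑ i ∈ Finset.range (m + 1), G i (m - i)) =
      ∑ i ∈ Finset.range (c + 1), PowerSeries.X ^ i * hbarSum (G i) := by
  ext1 N
  rw [coeff_hbarSum, map_sum]
  have h1 : ∀ m ∈ Finset.range (N + 1), PowerSeries.coeff (N - m)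
      (∑ i ∈ Finset.range (m + 1), G i (m - i)) =
      ∑ i ∈ Finset.range (m + 1), PowerSeries.coeff (N - i - (m - i)) (G i (m - i)) := by
    intro m _
    rw [map_sum]
    refine Finset.sum_congr rfl fun i hi => ?_
    rw [Finset.mem_range] at hi
    congr 2
    omega
  rw [Finset.sum_congr rfl h1,
    Finset.sum_range_diag_flip (N + 1) fun i m => PowerSeries.coeff (N - i - m) (G i m)]
  have h2 : ∀ i, (PowerSeries.coeff N) (PowerSeries.X ^ i * hbarSum (G i)) =
      if i < N + 1 then ∑ m ∈ Finset.range (N + 1 - i), PowerSeries.coeff (N - i - m) (G i m)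
        else 0 := by
    intro i
    rw [PowerSeries.coeff_X_pow_mul', coeff_hbarSum]
    simp only [Nat.lt_succ_iff]
    split_ifs with hi
    · rw [Nat.sub_add_comm hi]
    · rfl
  simp only [h2]
  rw [← Finset.sum_filter, ← Finset.sum_filter_add_sum_filter_not (Finset.range (N + 1)) (· < c + 1)]
  have h3 : ∑ i ∈ (Finset.range (N + 1)).filter (¬ · < c + 1),
      ∑ m ∈ Finset.range (N + 1 - i), PowerSeries.coeff (N - i - m) (G i m) = 0 := by
    refine Finset.sum_eq_zero fun i hi => Finset.sum_eq_zero fun m _ => ?_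
    rw [hG i (by simp at hi; omega), map_zero]
  rw [h3, add_zero]
  refine Finset.sum_congr ?_ fun _ _ => rfl
  ext i
  simp only [Finset.mem_filter, Finset.mem_range]
  exact and_comm

theorem hbarSum_smul (c : ℂ) (a : ℕ → PowerSeries Functional) :
    hbarSum (fun m => c • a m) = c • hbarSum a := by
  ext1 N
  simp [coeff_hbarSum, Finset.smul_sum]

theorem hbarSum_sum {ι : Type*} (s : Finset ι) (a : ι → ℕ → PowerSeries Functional) :
    hbarSum (fun m => ∑ i ∈ s, a i m) = ∑ i ∈ s, hbarSum (a i) := by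
  ext1 N
  simp only [coeff_hbarSum, map_sum]
  exact Finset.sum_comm

end Series

/-! ### Edges ending in a product -/

/-- The possible edges: those joining two of the `l + 1` factors of a time-ordered product, and
those joining one of the first `l` factors to an additional factor. -/
abbrev Letter (l : ℕ) : Type := Pairs (l + 1) ⊕ Fin l

/-- Of the `l + 2` factors the first `l` are the `A t`, followed by `B` and then `C`. -/
def letterSrc {l : ℕ} : Letter l → Fin (l + 2) :=
  Sum.elim (fun p => p.1.1.castSucc) (fun t => t.castSucc.castSucc)

def letterTgt {l : ℕ} : Letter l → Fin (l + 2) :=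
  Sum.elim (fun p => p.1.2.castSucc) (fun _ => Fin.last (l + 1))

/-- The first factor of a pair. -/
def pairFst {l : ℕ} (p : Pairs (l + 1)) : Fin l :=
  ⟨p.1.1, by have h1 := p.2; have h2 := p.1.2.2; rw [Fin.lt_def] at h1; omega⟩

/-- The word in which the edges in `S` are moved to the additional factor. -/
def moveWord {l m : ℕ} (e : Fin m → Pairs (l + 1)) (S : Finset (Fin m)) (a : Fin m) : Letter l :=
  if a ∈ S then Sum.inr (pairFst (e a)) else Sum.inl (e a)

/-- The word of a term of a time-ordered product with `d t` further edges from `t` to an additional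
factor. -/
def legWord {l m : ℕ} (e : Fin m → Pairs (l + 1)) (d : Fin l → ℕ) :
    Fin m ⊕ (Σ t : Fin l, Fin (d t)) → Letter l :=
  Sum.map e Sigma.fst

section Letters

variable {l m : ℕ} (e : Fin m → Pairs (l + 1)) (d : Fin l → ℕ)

theorem letterSrc_comp_moveWord (S : Finset (Fin m)) :
    letterSrc ∘ moveWord e S = Fin.castSucc ∘ fun a => (e a).1.1 := by
  ext a
  by_cases ha : a ∈ S <;> simp [letterSrc, moveWord, ha, pairFst]

theorem letterTgt_comp_moveWord (S : Finset (Fin m)) :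
    letterTgt ∘ moveWord e S = moveTgt (fun a => (e a).1.2) S := by
  ext a
  by_cases ha : a ∈ S <;> simp [letterTgt, moveWord, moveTgt, ha]

/-- The inverse reads each letter `t` as an edge from `t` to the last factor and records in `S`
where such letters occur. -/
theorem sum_moveWord {M : Type*} [AddCommMonoid M] (Ψ : (Fin m → Letter l) → M) :
    ∑ e : Fin m → Pairs (l + 1),
        ∑ S ∈ (Finset.univ.filter fun a => (e a).1.2 = Fin.last l).powerset, Ψ (moveWord e S) =
      ∑ g, Ψ g := by
  rw [Finset.sum_sigma']
  refine Finset.sum_bij' (fun x _ => moveWord x.1 x.2)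
    (fun g _ => ⟨fun a => Sum.elim id (fun t => ⟨(t.castSucc, Fin.last l), t.castSucc_lt_last⟩) (g a),
      Finset.univ.filter fun a => (g a).isRight⟩) ?_ ?_ ?_ ?_ ?_
  · exact fun _ _ => Finset.mem_univ _
  · intro g _
    simp only [Finset.mem_sigma, Finset.mem_univ, Finset.mem_powerset, true_and]
    intro a ha
    simp only [Finset.mem_filter, Finset.mem_univ, true_and] at ha ⊢
    obtain ⟨t, ht⟩ := Sum.isRight_iff.1 ha
    simp [ht]
  · rintro ⟨e, S⟩ hS
    simp only [Finset.mem_sigma, Finset.mem_univ, Finset.mem_powerset, true_and] at hS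
    have h1 : ∀ a, (moveWord e S a).isRight = true ↔ a ∈ S := by
      intro a
      by_cases ha : a ∈ S <;> simp [moveWord, ha]
    have h2 : (fun a => Sum.elim id (fun t => ⟨(t.castSucc, Fin.last l), t.castSucc_lt_last⟩)
        (moveWord e S a)) = e := by
      ext1 a
      by_cases ha : a ∈ S
      · have := hS ha
        simp only [Finset.mem_filter, Finset.mem_univ, true_and] at this
        simp only [moveWord, ha, if_true, Sum.elim_inr]
        -- Moving an edge forgets its target; membership in `S` says that it was the last factor.
        exact Subtype.ext (Prod.ext (Fin.ext rfl) this.symm)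
      · simp [moveWord, ha]
    simp only [h1, h2]
    simp
  · intro g _
    ext1 a
    rcases hg : g a with p | t
    · simp [moveWord, hg]
    · simp only [moveWord, hg, Finset.mem_filter, Finset.mem_univ, true_and, Sum.isRight_inr,
        if_true, Sum.elim_inr]
      rfl
  · intro x _
    rfl

theorem map_univ_legWord : Finset.univ.val.map (legWord e d) =
    (Finset.univ.val.map e).map Sum.inl + ∑ t, Multiset.replicate (d t) (Sum.inr t) := by
  have h : ∀ {α Z : Type} [Fintype α] (f : α → Z), Finset.univ.val.map f = ∑ x, {f x} := by
    intro α Z _ f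
    rw [← Multiset.sum_map_singleton (Finset.univ.val.map f), Multiset.map_map]
    rfl
  rw [h, Multiset.map_map, h, Fintype.sum_sum_type, Fintype.sum_sigma]
  simp [legWord, Multiset.nsmul_singleton]

/-- Sorting the letters by kind; this extends well-definedness from the terms in the hypothesis to
arbitrary words. -/
theorem exists_legWord {κ : Type} [Fintype κ] (g : κ → Letter l) :
    ∃ (m : ℕ) (e : Fin m → Pairs (l + 1)) (d : Fin l → ℕ),
      Finset.univ.val.map g = Finset.univ.val.map (legWord e d) := by
  have h1 : ∀ M : Multiset (Letter l), ∃ (M₁ : List (Pairs (l + 1))) (M₂ : Multiset (Fin l)),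
      M = Multiset.map Sum.inl (M₁ : Multiset _) + M₂.map Sum.inr := by
    intro M
    induction M using Multiset.induction_on with
    | empty => exact ⟨[], 0, by simp⟩
    | cons a M ih =>
      obtain ⟨M₁, M₂, rfl⟩ := ih
      rcases a with p | t
      · exact ⟨p :: M₁, M₂, by simp [← Multiset.cons_coe]⟩
      · exact ⟨M₁, t ::ₘ M₂, by simp⟩
  obtain ⟨M₁, M₂, hM⟩ := h1 (Finset.univ.val.map g)
  refine ⟨M₁.length, M₁.get, fun t => M₂.count t, ?_⟩
  have h2 : M₂ = ∑ t, Multiset.replicate (M₂.count t) t := by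
    ext t
    simp [Multiset.count_sum', Multiset.count_replicate]
  rw [hM, map_univ_legWord, Fin.univ_val_map, List.ofFn_get]
  congr 1
  conv_lhs => rw [h2]
  rw [← Multiset.coe_mapAddMonoidHom, map_sum]
  simp

/-- The legs of `timeOrderedPaired`, without those of the last factor of the product. -/
def legEquiv (m : ℕ) : Fin m ⊕ (Σ t : Fin l, Fin (d t)) ≃
    LegEdges m (Fin.snoc (α := fun _ => ℕ) d 0) :=
  (Equiv.refl _).sumCongr <| Equiv.ofBijective
    (fun s => ⟨s.1.castSucc, Fin.cast (by simp) s.2⟩) <| by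
      constructor
      · rintro ⟨t, i⟩ ⟨t', i'⟩ h
        obtain ⟨h1, h2⟩ := Sigma.mk.inj_iff.1 h
        obtain rfl := Fin.castSucc_injective _ h1
        simpa using h2
      · rintro ⟨t, i⟩
        induction t using Fin.lastCases with
        -- The factor `B` has no legs to `C`, so this index type is empty.
        | last => exact (Fin.cast (by simp) i : Fin 0).elim0
        | cast t => exact ⟨⟨t, Fin.cast (by simp) i⟩, rfl⟩

theorem legSrc_comp_legEquiv :
    legSrc (Fin.snoc (α := fun _ => ℕ) d 0) e ∘ legEquiv d m = letterSrc ∘ legWord e d := by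
  ext (a | s) <;> rfl

theorem legTgt_comp_legEquiv :
    legTgt (Fin.snoc (α := fun _ => ℕ) d 0) e ∘ legEquiv d m = letterTgt ∘ legWord e d := by
  ext (a | s) <;> rfl

theorem filter_legWord_last :
    (Finset.univ.filter fun j => Sum.elim (letterSrc ∘ legWord e d) (letterTgt ∘ legWord e d) j =
      Fin.last (l + 1)).card = ∑ t, d t := by
  have : (Finset.univ.filter fun j => Sum.elim (letterSrc ∘ legWord e d)
      (letterTgt ∘ legWord e d) j = Fin.last (l + 1)) =
      ((Finset.univ : Finset (Σ t : Fin l, Fin (d t))).map Function.Embedding.inr).map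
        Function.Embedding.inr := by
    ext (j | j)
    · rcases j with a | s
      · simp [letterSrc, legWord, Fin.ext_iff]; omega
      · simp [letterSrc, legWord, Fin.ext_iff]; omega
    · rcases j with a | s
      · simp [letterTgt, legWord, Fin.ext_iff]; omega
      · refine iff_of_true (Finset.mem_filter.2 ⟨Finset.mem_univ _, rfl⟩) ?_
        simp only [Finset.mem_map, Finset.mem_univ, true_and, exists_exists_eq_and]
        exact ⟨s, rfl⟩
  rw [this, Finset.card_map, Finset.card_map]
  simp

end Letters

/-! ### Time-ordered products with a product of functionals -/

section Main

open Finset in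
-- The order in `ħ` of the coefficient of `B * C` is split between `B` and `C`.
theorem sum_antidiagonal_last {l : ℕ} {M : Type*} [AddCommMonoid M] (N : ℕ)
    (Ψ : (Fin (l + 2) → ℕ) → M) :
    ∑ k ∈ piAntidiag (univ : Finset (Fin (l + 1))) N, ∑ p ∈ HasAntidiagonal.antidiagonal (k (Fin.last l)),
        Ψ (Fin.snoc (α := fun _ => ℕ) (Fin.snoc (α := fun _ => ℕ) (Fin.init k) p.1) p.2) =
      ∑ k ∈ piAntidiag (univ : Finset (Fin (l + 2))) N, Ψ k := by
  rw [sum_sigma']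
  refine sum_bij' (fun x _ => Fin.snoc (α := fun _ => ℕ)
      (Fin.snoc (α := fun _ => ℕ) (Fin.init x.1) x.2.1) x.2.2)
    (fun k _ => ⟨Fin.snoc (α := fun _ => ℕ) (Fin.init (Fin.init k))
      (k (Fin.last l).castSucc + k (Fin.last (l + 1))),
      (k (Fin.last l).castSucc, k (Fin.last (l + 1)))⟩) ?_ ?_ ?_ ?_ ?_
  · rintro ⟨k, p⟩ h
    simp only [mem_sigma, mem_piAntidiag, HasAntidiagonal.mem_antidiagonal, Fin.sum_univ_castSucc, mem_univ,
      implies_true, and_true] at h ⊢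
    simp only [Fin.snoc_castSucc, Fin.snoc_last, Fin.init]
    omega
  · intro k h
    simp only [mem_sigma, mem_piAntidiag, HasAntidiagonal.mem_antidiagonal, Fin.sum_univ_castSucc, mem_univ,
      implies_true, and_true] at h ⊢
    simp only [Fin.snoc_castSucc, Fin.snoc_last, Fin.init]
    exact ⟨by omega, trivial⟩
  · rintro ⟨k, p⟩ h
    simp only [mem_sigma, HasAntidiagonal.mem_antidiagonal] at h
    simp only [Fin.init_snoc, Fin.snoc_last, Fin.snoc_castSucc, h.2, Fin.snoc_init_self]
  · intro k h
    have e1 : Fin.snoc (α := fun _ => ℕ) (Fin.init (Fin.init k)) (k (Fin.last l).castSucc) =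
        Fin.init k := Fin.snoc_init_self (α := fun _ => ℕ) (Fin.init k)
    simp only [Fin.init_snoc, e1]
    exact Fin.snoc_init_self (α := fun _ => ℕ) k
  · intro x _
    rfl

variable {Δ : Bidistribution} {l c : ℕ} {A : Fin l → PowerSeries Functional}
  {B C : PowerSeries Functional}

theorem isSmoothAlong_snoc {n : ℕ} {F : Fin n → PowerSeries Functional} {G : PowerSeries Functional}
    (hF : ∀ i k, IsSmoothAlong (PowerSeries.coeff k (F i)))
    (hG : ∀ k, IsSmoothAlong (PowerSeries.coeff k G)) (i : Fin (n + 1)) (k : ℕ) :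
    IsSmoothAlong (PowerSeries.coeff k (Fin.snoc (α := fun _ => PowerSeries Functional) F G i)) := by
  induction i using Fin.lastCases with
  | last => simpa using hG k
  | cast i => simpa using hF i k

theorem hasContraction_legWord_zero {n : ℕ} {F : Fin (l + 1) → PowerSeries Functional}
    (hC : ∀ k, IsSmoothAlong (PowerSeries.coeff k C))
    (hc : ∀ i > c, ∀ (k : ℕ) (φ : Config),
      IsFunctionalDeriv (PowerSeries.coeff k C) φ (0 : CompactDistribution (Fin i)))
    (e : Fin n → Pairs (l + 1)) {d : Fin l → ℕ} (hd : c < ∑ t, d t) (k : Fin (l + 2) → ℕ)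
    (φ : Config) :
    HasContraction Δ (fun i => PowerSeries.coeff (k i)
        (Fin.snoc (α := fun _ => PowerSeries Functional) F C i))
      (letterSrc ∘ legWord e d) (letterTgt ∘ legWord e d) φ 0 := by
  refine HasContraction.zero (Fin.last (l + 1)) fun h => ?_
  simp only [Fin.snoc_last]
  have h1 := dirDeriv_subtype h ⟨_, hC (k (Fin.last (l + 1)))⟩ φ (fun j =>
    Sum.elim (letterSrc ∘ legWord e d) (letterTgt ∘ legWord e d) j = Fin.last (l + 1))
  refine h1.trans (iterDir_eq_zero_of_card h ?_)
  exact hc _ (by rw [filter_legWord_last]; exact hd) _ φ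

/-- Up to rearrangement only `legWord` matters; its contraction is well defined by assumption when
`∑ d t ≤ c` and is zero otherwise. -/
theorem contractionDefined_letters
    (hA : ∀ t k, IsSmoothAlong (PowerSeries.coeff k (A t)))
    (hB : ∀ k, IsSmoothAlong (PowerSeries.coeff k B))
    (hC : ∀ k, IsSmoothAlong (PowerSeries.coeff k C))
    (hc : ∀ i > c, ∀ (k : ℕ) (φ : Config),
      IsFunctionalDeriv (PowerSeries.coeff k C) φ (0 : CompactDistribution (Fin i)))
    (hdef : ∀ d : Fin l → ℕ, ∑ t, d t ≤ c →
      TimeOrderedPairedDefined Δ (Fin.snoc (α := fun _ => PowerSeries Functional) A B)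
        (Fin.snoc (α := fun _ => ℕ) d 0) C)
    {κ : Type} [Fintype κ] (g : κ → Letter l) :
    ContractionDefined Δ (Fin.snoc (α := fun _ => PowerSeries Functional)
      (Fin.snoc (α := fun _ => PowerSeries Functional) A B) C) (letterSrc ∘ g) (letterTgt ∘ g) := by
  have hF := isSmoothAlong_snoc (isSmoothAlong_snoc hA hB) hC
  obtain ⟨m, e, d, h⟩ := exists_legWord g
  refine contractionDefined_of_map_eq hF letterSrc letterTgt h ?_
  by_cases hd : ∑ t, d t ≤ c
  · rw [← legSrc_comp_legEquiv, ← legTgt_comp_legEquiv, contractionDefined_comp_equiv hF]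
    exact hdef d hd m e
  · exact fun k φ => ⟨0, hasContraction_legWord_zero hC hc e (not_le.1 hd) k φ⟩

theorem hasContraction_mul
    (hA : ∀ t k, IsSmoothAlong (PowerSeries.coeff k (A t)))
    (hB : ∀ k, IsSmoothAlong (PowerSeries.coeff k B))
    (hC : ∀ k, IsSmoothAlong (PowerSeries.coeff k C))
    (hdef : ∀ {m : ℕ} (g : Fin m → Letter l), ContractionDefined Δ
      (Fin.snoc (α := fun _ => PowerSeries Functional)
        (Fin.snoc (α := fun _ => PowerSeries Functional) A B) C) (letterSrc ∘ g) (letterTgt ∘ g))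
    {m : ℕ} (e : Fin m → Pairs (l + 1)) (k : Fin (l + 1) → ℕ) (φ : Config) :
    HasContraction Δ (fun i => PowerSeries.coeff (k i)
        (Fin.snoc (α := fun _ => PowerSeries Functional) A (B * C) i))
      (fun a => (e a).1.1) (fun a => (e a).1.2) φ
      (∑ p ∈ Finset.HasAntidiagonal.antidiagonal (k (Fin.last l)),
        ∑ S ∈ (Finset.univ.filter fun a => (e a).1.2 = Fin.last l).powerset,
          contraction Δ (fun i => PowerSeries.coeff (Fin.snoc (α := fun _ => ℕ)
              (Fin.snoc (α := fun _ => ℕ) (Fin.init k) p.1) p.2 i)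
            (Fin.snoc (α := fun _ => PowerSeries Functional)
              (Fin.snoc (α := fun _ => PowerSeries Functional) A B) C i))
            (letterSrc ∘ moveWord e S) (letterTgt ∘ moveWord e S) φ) := by
  have key := HasContraction.sum_mul (Δ := Δ) (Finset.HasAntidiagonal.antidiagonal (k (Fin.last l)))
    (fun t => ⟨_, hA t (k t.castSucc)⟩) (fun p => ⟨_, hB p.1⟩) (fun p => ⟨_, hC p.2⟩)
    (src := fun a => (e a).1.1) (tgt := fun a => (e a).1.2)
    (fun a => ((e a).2.trans_le (Fin.le_last _)).ne) (φ := φ)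
    (z := fun p S => contraction Δ (fun i => PowerSeries.coeff (Fin.snoc (α := fun _ => ℕ)
              (Fin.snoc (α := fun _ => ℕ) (Fin.init k) p.1) p.2 i)
            (Fin.snoc (α := fun _ => PowerSeries Functional)
              (Fin.snoc (α := fun _ => PowerSeries Functional) A B) C i))
            (letterSrc ∘ moveWord e S) (letterTgt ∘ moveWord e S) φ) ?_
  · convert! key using 1
    ext1 i
    induction i using Fin.lastCases with
    | last =>
      simp only [Fin.snoc_last, PowerSeries.coeff_mul]
      rw [AddSubmonoidClass.coe_finsetSum]
      rfl
    | cast i => simp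
  · intro p _ S _
    obtain ⟨z, hz⟩ := hdef (moveWord e S) (Fin.snoc (α := fun _ => ℕ)
              (Fin.snoc (α := fun _ => ℕ) (Fin.init k) p.1) p.2) φ
    rw [hz.contraction_eq]
    rw [letterSrc_comp_moveWord, letterTgt_comp_moveWord] at hz
    convert! hz using 1
    ext1 i
    induction i using Fin.lastCases with
    | last => simp
    | cast i =>
      induction i using Fin.lastCases with
      | last => simp
      | cast i => simp [Fin.init]

theorem timeOrderedPaired_snoc_zero {F : Fin (l + 1) → PowerSeries Functional}
    (hF : ∀ i k, IsSmoothAlong (PowerSeries.coeff k (F i)))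
    (hC : ∀ k, IsSmoothAlong (PowerSeries.coeff k C)) (d : Fin l → ℕ) :
    timeOrderedPaired Δ F (Fin.snoc (α := fun _ => ℕ) d 0) C =
      hbarSum fun m => (m.factorial : ℂ)⁻¹ • ∑ e : Fin m → Pairs (l + 1),
        contractionSeries Δ (Fin.snoc (α := fun _ => PowerSeries Functional) F C)
          (letterSrc ∘ legWord e d) (letterTgt ∘ legWord e d) := by
  refine hbarSum_congr fun m => ?_
  congr 1
  refine Finset.sum_congr rfl fun e _ => ?_
  rw [← legSrc_comp_legEquiv, ← legTgt_comp_legEquiv]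
  exact (contractionSeries_comp_equiv (isSmoothAlong_snoc hF hC) (legEquiv d m)
    (src := legSrc _ e) (tgt := legTgt _ e)).symm

end Main

end PAQFT

open PAQFT in
theorem mainTheorem11 (Δ : PAQFT.Bidistribution) (l c : ℕ)
    (A : Fin l → PowerSeries PAQFT.Functional) (B C : PowerSeries PAQFT.Functional)
    (hA : ∀ t k, PAQFT.IsSmooth (PowerSeries.coeff k (A t)))
    (hB : ∀ k, PAQFT.IsSmooth (PowerSeries.coeff k B))
    (hC : ∀ k, PAQFT.IsSmooth (PowerSeries.coeff k C))
    (hc : ∀ i > c, ∀ (k : ℕ) (φ : PAQFT.Config),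
      PAQFT.IsFunctionalDeriv (PowerSeries.coeff k C) φ (0 : PAQFT.CompactDistribution (Fin i)))
    (hdef : ∀ d : Fin l → ℕ, ∑ t, d t ≤ c →
      PAQFT.TimeOrderedPairedDefined Δ
        (Fin.snoc (α := fun _ => PowerSeries PAQFT.Functional) A B)
        (Fin.snoc (α := fun _ => ℕ) d 0) C) :
    PAQFT.TimeOrderedDefined Δ
        (Fin.snoc (α := fun _ => PowerSeries PAQFT.Functional) A (B * C)) ∧
      PAQFT.timeOrdered Δ
          (Fin.snoc (α := fun _ => PowerSeries PAQFT.Functional) A (B * C)) =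
        ∑ i ∈ Finset.range (c + 1), PowerSeries.X ^ i *
          ∑ d ∈ Finset.piAntidiag (Finset.univ : Finset (Fin l)) i,
            (∏ t, ((d t).factorial : ℂ))⁻¹ •
              PAQFT.timeOrderedPaired Δ
                (Fin.snoc (α := fun _ => PowerSeries PAQFT.Functional) A B)
                (Fin.snoc (α := fun _ => ℕ) d 0) C := by
  have hA' : ∀ t k, IsSmoothAlong (PowerSeries.coeff k (A t)) := fun t k => (hA t k).1
  have hB' : ∀ k, IsSmoothAlong (PowerSeries.coeff k B) := fun k => (hB k).1
  have hC' : ∀ k, IsSmoothAlong (PowerSeries.coeff k C) := fun k => (hC k).1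
  set F := Fin.snoc (α := fun _ => PowerSeries Functional)
      (Fin.snoc (α := fun _ => PowerSeries Functional) A B) C with hFdef
  have hF : ∀ i k, IsSmoothAlong (PowerSeries.coeff k (F i)) :=
    isSmoothAlong_snoc (isSmoothAlong_snoc hA' hB') hC'
  have hmul := fun {m : ℕ} (e : Fin m → Pairs (l + 1)) => hasContraction_mul hA' hB' hC'
    (fun g => contractionDefined_letters hA' hB' hC' hc hdef g) e
  refine ⟨fun m e k φ => ⟨_, hmul e k φ⟩, ?_⟩
  -- The multiset serves as its own set of edges, which makes the contraction a function of the
  -- multiset alone.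
  let Φ : Multiset (Letter l) → PowerSeries Functional := fun M =>
    contractionSeries Δ F (letterSrc ∘ fun x : M => x.1) (letterTgt ∘ fun x : M => x.1)
  have hΦ : ∀ {κ : Type} [Fintype κ] (g : κ → Letter l),
      contractionSeries Δ F (letterSrc ∘ g) (letterTgt ∘ g) = Φ (Finset.univ.val.map g) :=
    fun g => contractionSeries_eq_of_map_eq hF letterSrc letterTgt (Multiset.map_univ_coe _).symm
  have hseries : ∀ {m : ℕ} (e : Fin m → Pairs (l + 1)),
      contractionSeries Δ (Fin.snoc (α := fun _ => PowerSeries Functional) A (B * C))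
        (fun a => (e a).1.1) (fun a => (e a).1.2) =
      ∑ S ∈ (Finset.univ.filter fun a => (e a).1.2 = Fin.last l).powerset,
        Φ (Finset.univ.val.map (moveWord e S)) := by
    intro m e
    ext1 N
    rw [map_sum]
    simp only [← hΦ, contractionSeries, PowerSeries.coeff_mk]
    rw [Finset.sum_comm, ← sum_antidiagonal_last]
    refine Finset.sum_congr rfl fun k _ => ?_
    ext1 φ
    rw [(hmul e k φ).contraction_eq]
    simp only [Finset.sum_apply]
    rfl
  let G : ℕ → ℕ → PowerSeries Functional := fun i m =>
    ∑ d ∈ Finset.piAntidiag (Finset.univ : Finset (Fin l)) i,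
      (∏ t, ((d t).factorial : ℂ))⁻¹ • (m.factorial : ℂ)⁻¹ •
        ∑ e : Fin m → Pairs (l + 1), Φ ((Finset.univ.val.map e).map Sum.inl +
          ∑ t, Multiset.replicate (d t) (Sum.inr t))
  have hG : ∀ i > c, ∀ m, G i m = 0 := by
    intro i hi m
    refine Finset.sum_eq_zero fun d hd => ?_
    have hd' : ∑ t, d t = i := (Finset.mem_piAntidiag.1 hd).1
    rw [Finset.sum_eq_zero, smul_zero, smul_zero]
    intro e _
    rw [← map_univ_legWord, ← hΦ]
    exact contractionSeries_eq_zero fun k φ =>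
      hasContraction_legWord_zero hC' hc e (by omega) k φ
  have h1 : timeOrdered Δ (Fin.snoc (α := fun _ => PowerSeries Functional) A (B * C)) =
      hbarSum fun m => ∑ i ∈ Finset.range (m + 1), G i (m - i) := by
    refine hbarSum_congr fun m => ?_
    simp only [hseries]
    -- Words with subsets become words in the larger alphabet, which are then sorted by their
    -- letters ending at `C`.
    rw [sum_moveWord fun g => Φ (Finset.univ.val.map g), sum_words_eq]
  rw [h1, hbarSum_sum_range G hG]
  refine Finset.sum_congr rfl fun i _ => ?_
  congr 1
  rw [hbarSum_sum]
  refine Finset.sum_congr rfl fun d _ => ?_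
  rw [hbarSum_smul, timeOrderedPaired_snoc_zero (isSmoothAlong_snoc hA' hB') hC']
  simp only [← map_univ_legWord, ← hΦ]
  rfl

end
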